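/- **Setting.** An *instruction sequence* is a non-empty finite sequence of instructions, each of which is a plain basic instruction $a$, a positive test $+a$, a negative test $-a$, a forward jump $\#l$ ($l\in\mathbb N$), or the termination instruction $!$. Let $\mathit{IS}_{\mathrm{br}}$ be the set of instruction sequences whose basic instructions $a$ act on Boolean registers as follows: read an input register $\mathsf{in}{:}i$; read an auxiliary register $\mathsf{aux}{:}i$; write a Boolean value to an auxiliary register or to the output register $\mathsf{out}$. Reading replies the content of the register, writing replies the value written. Execution starts at the first instruction. After $a$ execution proceeds with the next instruction; after $+a$ (resp. $-a$) it does so if the reply is true (resp. false), and otherwise it skips one instruction; after $\#l$ it proceeds with the $l$-th next instruction; $!$ terminates. Execution becomes inactive at $\#0$ and when there is no instruction to proceed with. A sequence $X\in \mathit{IS}_{\mathrm{br}}$ *computes* $f:\{0,1\}^n\to\{0,1\}$ if there is an $l\in\mathbb N$ such that for all $b_1,\dots,b_n$, when only $\mathsf{in}{:}1,\dots,\mathsf{in}{:}n$ (containing $b_1,\dots,b_n$), $\mathsf{aux}{:}1,\dots,\mathsf{aux}{:}l$ and $\mathsf{out}$ (all initially false) are available, execution of $X$ terminates with $f(b_1,\dots,b_n)$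 in $\mathsf{out}$. Let $\mathrm{PLIS}$ be the class of all Boolean function families $(f_n)_{n\in\mathbb N}$, $f_n:\{0,1\}^n\to\{0,1\}$, for which there is a polynomial function $h:\mathbb N\to\mathbb N$ such that for every $n$ some $X\in \mathit{IS}_{\mathrm{br}}$ of length at most $h(n)$ computes $f_n$. Let $D(k)=\binom{2k}{1}+\binom{2k}{2}+\binom{2k}{3}$, and let $(\alpha_k)_{k\in\mathbb N}$ be any family of bijections from $\{1,\dots,D(k)\}$ onto the set of all sets of one, two or three literals over the variables $v_1,\dots,v_k$, such that $\alpha_{k+1}(j)=\alpha_k(j)$ for all $k$ and all $j\le D(k)$. For $n\in\mathbb N$ let $k$ be the unique number with $D(k)\le n<D(k+1)$; then $\mathrm{3SATC}_n(b_1,\dots,b_n)$ is true iff the formula $$\bigwedge_{i\le D(k),\ b_i=1}\ \bigvee \alpha_k(i)$$ is satisfiable. Let $\mathrm{3SATC}=(\mathrm{3SATC}_n)_{n\in\mathbb N}$. Let $\mathrm{3SAT}\subseteq\{0,1\}^*$ be the language of all (binary encoded) satisfiable CNF formulas with at most three literals per clause. Let $\mathrm{P/poly}$ be the class of languages decided by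 polynomial-size families of Boolean circuits, and $\mathrm{NP}$ the class of languages with polynomial-length certificates that are verifiable in polynomial time by a Turing machine. **Theorem.** The *non-uniform super-polynomial complexity conjecture* is the statement $\mathrm{3SATC}\notin\mathrm{PLIS}$. It is equivalent to the statement $\mathrm{3SAT}\notin\mathrm{P/poly}$, and it is equivalent to the statement $\mathrm{NP}\not\subseteq\mathrm{P/poly}$. That is, $$\mathrm{3SATC}\notin\mathrm{PLIS}\iff \mathrm{3SAT}\notin\mathrm{P/poly},\qquad \mathrm{3SATC}\notin\mathrm{PLIS}\iff \mathrm{NP}\not\subseteq\mathrm{P/poly}.$$ -/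

import Mathlib

namespace NonuniformIS

/-! ### Single-pass instruction sequences acting on Boolean registers

All registers and propositional variables are numbered from `0`. -/

/-- Foci: names of the input registers, the auxiliary registers and the output register. -/
inductive Focus where
  | inp (i : ℕ)
  | aux (i : ℕ)
  | out
  deriving DecidableEq

/-- Methods that Boolean register services can process. -/
inductive Meth where
  | set (b : Bool)
  | get

/-- Basic instructions (also the basic actions of threads) `f.m`. -/
structure BasicInstr where
  focus : Focus
  meth : Meth

/-- Primitive instructions. -/
inductive PrimInstr where
  /-- plain basic instruction `a` -/
  | plain (a : BasicInstr)
  /-- positive test instruction `+a` -/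
  | posTest (a : BasicInstr)
  /-- negative test instruction `-a` -/
  | negTest (a : BasicInstr)
  /-- forward jump instruction `#l` -/
  | jump (l : ℕ)
  /-- termination instruction `!` -/
  | halt

/-- Finite threads: inaction `D`, termination `S`, internal action prefixing `tau ∘ p`, and
postconditional composition `p ⊴ a ⊵ q` (first `a`, then `p` on reply true, `q` on reply false).
Since `p ⊴ tau ⊵ q = p ⊴ tau ⊵ p`, the internal action needs only one continuation. -/
inductive Thread where
  | inaction
  | terminated
  | tau (p : Thread)
  | pcc (p : Thread) (a : BasicInstr) (q : Thread)

/-- Thread extraction: the behaviour produced by an instruction sequence. The empty list is only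
reached when there is no primitive instruction to proceed with, in which case inaction occurs. -/
def extract : List PrimInstr → Thread
  | [] => .inaction
  | .plain a :: X => .pcc (extract X) a (extract X)
  | .posTest a :: X => .pcc (extract X) a (extract (X.drop 1))
  | .negTest a :: X => .pcc (extract (X.drop 1)) a (extract X)
  | .jump 0 :: _ => .inaction
  | .jump (l + 1) :: X => extract (X.drop l)
  | .halt :: _ => .terminated
  termination_by X => X.length
  decreasing_by all_goals simp only [List.length_cons, List.length_drop]; omega

/-- Services: the empty service and the Boolean register with content `b`. -/
inductive Service where
  | empty
  | reg (b : Bool)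

/-- The derived service after processing a method. -/
def Service.derive : Meth → Service → Service
  | _, .empty => .empty
  | .set b, .reg _ => .reg b
  | .get, .reg b => .reg b

/-- The reply of a service to a method; `none` is the reply "blocked". -/
def Service.reply : Meth → Service → Option Bool
  | _, .empty => none
  | .set b, .reg _ => some b
  | .get, .reg b => some b

/-- The use operator: the thread that results when the service `S`, named `f`, processes the
actions `f.m` of the thread. -/
def Thread.use (f : Focus) : Thread → Service → Thread
  | .inaction, _ => .inaction
  | .terminated, _ => .terminated
  | .tau p, S => .tau (p.use f S)
  | .pcc p a q, S =>
    if a.focus = f then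
      match S.reply a.meth with
      | some true => .tau (p.use f (S.derive a.meth))
      | some false => .tau (q.use f (S.derive a.meth))
      | none => .tau .inaction
    else .pcc (p.use f S) a (q.use f S)

/-- The apply operator: the service that results when the service `S`, named `f`, processes the
actions `f.m` of the thread. -/
def Thread.apply (f : Focus) : Thread → Service → Service
  | .inaction, _ => .empty
  | .terminated, S => S
  | .tau p, S => p.apply f S
  | .pcc p a q, S =>
    if a.focus = f then
      match S.reply a.meth with
      | some true => p.apply f (S.derive a.meth)
      | some false => q.apply f (S.derive a.meth)
      | none => .empty
    else .empty

/-- Basic instructions allowed in the instruction sequences considered: input registers can be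
read, auxiliary registers can be read and written, the output register can be written. -/
def BasicInstr.IsAllowed : BasicInstr → Prop
  | ⟨.inp _, .get⟩ => True
  | ⟨.aux _, _⟩ => True
  | ⟨.out, .set _⟩ => True
  | _ => False

/-- Primitive instructions built from allowed basic instructions. -/
def PrimInstr.IsAllowed : PrimInstr → Prop
  | .plain a | .posTest a | .negTest a => a.IsAllowed
  | .jump _ | .halt => True

/-- The set of all (non-empty, finite) instruction sequences acting on Boolean registers. -/
def ISbr : Set (List PrimInstr) :=
  {X | X ≠ [] ∧ ∀ u ∈ X, u.IsAllowed}

/-- `X` computes the Boolean function `f`: for some number `l` of auxiliary registers, all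
initially false, running `X` with its input registers containing `b` and its output register
initially false leaves `f b` in the output register. -/
def Computes {n : ℕ} (X : List PrimInstr) (f : (Fin n → Bool) → Bool) : Prop :=
  ∃ l : ℕ, ∀ b : Fin n → Bool,
    let p₁ := (List.range l).foldl (fun p i => p.use (.aux i) (.reg false)) (extract X)
    let p₂ := (List.finRange n).foldl (fun p i => p.use (.inp i) (.reg (b i))) p₁
    p₂.apply .out (.reg false) = .reg (f b)

/-- Boolean function families. -/
abbrev BoolFunFamily : Type := ∀ n : ℕ, (Fin n → Bool) → Bool

/-- The class of families computed by instruction sequences from `IS` of length bounded by a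
function from `F`. -/
def nuc (IS : Set (List PrimInstr)) (F : Set (ℕ → ℕ)) : Set BoolFunFamily :=
  {f | ∃ h ∈ F, ∀ n, ∃ X ∈ IS, Computes X (f n) ∧ X.length ≤ h n}

/-- The polynomial functions from `ℕ` to `ℕ`. -/
def poly : Set (ℕ → ℕ) :=
  {h | ∃ p : Polynomial ℚ, ∀ n : ℕ, (h n : ℚ) = p.eval (n : ℚ)}

/-- Families computable by polynomial-length instruction sequences. -/
def PLIS : Set BoolFunFamily := nuc ISbr poly

/-! ### 3-CNF formulas, 3SAT and 3SATC -/

/-- The literal `(v, true)` is the variable `v`, the literal `(v, false)` is its negation. -/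
abbrev Literal : Type := ℕ × Bool

/-- Truth of a literal under an assignment. -/
def Literal.Holds (σ : ℕ → Bool) (l : Literal) : Prop := σ l.1 = l.2

/-- CNF formulas: conjunctions of disjunctions of literals. -/
abbrev CNF : Type := List (List Literal)

/-- Satisfiability of a CNF formula. -/
def CNF.Satisfiable (φ : CNF) : Prop :=
  ∃ σ : ℕ → Bool, ∀ c ∈ φ, ∃ l ∈ c, Literal.Holds σ l

/-- Formulas in which every clause has at most three literals. -/
def CNF.Is3CNF (φ : CNF) : Prop := ∀ c ∈ φ, c.length ≤ 3

/-- Code of a literal: its sign, then the binary digits of the variable's number, least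
significant first, each preceded by `true`, then `false`. -/
def encodeLiteral (l : Literal) : List Bool :=
  l.2 :: (l.1.bits.flatMap (fun b => [true, b]) ++ [false])

/-- Code of a clause: the codes of its literals, each preceded by `true`, then `false`. -/
def encodeClause (c : List Literal) : List Bool :=
  c.flatMap (fun l => true :: encodeLiteral l) ++ [false]

/-- Code of a CNF formula: the codes of its clauses, concatenated (each is self-delimiting). -/
def encodeCNF (φ : CNF) : List Bool := φ.flatMap encodeClause

/-- The language of (codes of) satisfiable 3-CNF formulas. -/
def threeSAT : Language Bool :=
  {w | ∃ φ : CNF, φ.Is3CNF ∧ φ.Satisfiable ∧ encodeCNF φ = w}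

/-- The number of sets of one, two or three literals over `k` variables. -/
def numDisj (k : ℕ) : ℕ := (2 * k).choose 1 + (2 * k).choose 2 + (2 * k).choose 3

/-- The sets of one, two or three literals over the first `k` variables. -/
def disjSets (k : ℕ) : Set (Finset Literal) :=
  {L | (∀ l ∈ L, l.1 < k) ∧ 1 ≤ L.card ∧ L.card ≤ 3}

/-- A coherent family of numberings: `disj k` numbers the disjunctions over the first `k`
variables bijectively by `0, ..., numDisj k - 1` (its values elsewhere are irrelevant), and
`disj (k + 1)` extends `disj k`. -/
structure DisjNumbering where
  disj : ℕ → ℕ → Finset Literal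
  bijOn : ∀ k, Set.BijOn (disj k) (Set.Iio (numDisj k)) (disjSets k)
  coherent : ∀ k, ∀ j < numDisj k, disj (k + 1) j = disj k j

/-- The greatest `k` with `numDisj k ≤ n`. As `numDisj` is strictly increasing from `0`, this is
the unique `k` with `numDisj k ≤ n < numDisj (k + 1)`. -/
def numVars (n : ℕ) : ℕ := Nat.findGreatest (fun k => numDisj k ≤ n) n

open Classical in
/-- The family 3SATC: with `k = numVars n`, the first `numDisj k` bits of `b` say which
disjunctions over the first `k` variables occur in the formula, the other bits are ignored, and
the value says whether that formula is satisfiable. -/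
noncomputable def threeSATC (α : DisjNumbering) : BoolFunFamily := fun n b =>
  decide (∃ σ : ℕ → Bool, ∀ i : Fin n, (i : ℕ) < numDisj (numVars n) → b i = true →
    ∃ l ∈ α.disj (numVars n) i, Literal.Holds σ l)

/-! ### Boolean circuits and P/poly -/

/-- The gates whose predecessors are among `m` earlier nodes. -/
inductive Gate (m : ℕ) where
  | const (b : Bool)
  | not (i : Fin m)
  | and (i j : Fin m)
  | or (i j : Fin m)

/-- The output of a gate, given the values of the earlier nodes. -/
def Gate.eval {m : ℕ} (v : Fin m → Bool) : Gate m → Bool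
  | .const b => b
  | .not i => !(v i)
  | .and i j => v i && v j
  | .or i j => v i || v j

/-- Boolean circuits (directed acyclic graphs, listed in topological order) with `n` input nodes
and `s` nodes altogether. -/
inductive Circuit (n : ℕ) : ℕ → Type where
  | inputs : Circuit n n
  | snoc {s : ℕ} (C : Circuit n s) (g : Gate s) : Circuit n (s + 1)

/-- The values of all nodes of a circuit on input `x`. -/
def Circuit.eval {n : ℕ} (x : Fin n → Bool) : {s : ℕ} → Circuit n s → Fin s → Bool
  | _, .inputs => x
  | _, .snoc C g => Fin.snoc (α := fun _ => Bool) (C.eval x) (g.eval (C.eval x))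

/-- P/poly: the languages decided by families of polynomial-size Boolean circuits with one
output node, the size being the number of nodes. -/
def PPoly : Set (Language Bool) :=
  {L | ∃ h ∈ poly, ∀ n, ∃ s ≤ h n, ∃ (C : Circuit n s) (o : Fin s),
    ∀ x : Fin n → Bool, C.eval x o = true ↔ List.ofFn x ∈ L}

/-! ### NP -/

/-- The Boolean function `V` of two binary words is computable in polynomial time. -/
def PolyTimeVerifier (V : List Bool → List Bool → Bool) : Prop :=
  Nonempty (Turing.TM2ComputableInPolyTime
    (Computability.encodingProd (Computability.encodingList Bool)
      (Computability.encodingList Bool)).encode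
    Computability.encodeBool (fun xu : List Bool × List Bool => V xu.1 xu.2))

/-- NP: the languages with polynomial-length certificates that are verifiable in polynomial
time. -/
def NP : Set (Language Bool) :=
  {L | ∃ h ∈ poly, ∃ V : List Bool → List Bool → Bool, PolyTimeVerifier V ∧
    ∀ x : List Bool, x ∈ L ↔ ∃ u : List Bool, u.length = h x.length ∧ V x u = true}

end NonuniformIS

/-!
Jumps only go forward, so the execution of an instruction sequence is a single pass over its
positions, during which a circuit can track the registers and the pending position; conversely,
the gates of a circuit can be evaluated one after another into auxiliary registers. Hence `PLIS`
consists of the families of polynomial circuit size.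

A language in NP has nondeterministic circuits of polynomial size, obtained by unrolling its
verifier. Tseitin's clauses describe the acceptance of such a circuit, and the input only decides
which unit clauses fix the values of the input nodes. So every bit of the resulting instance of
3SATC depends on at most one input bit, and polynomial circuit size carries over from 3SATC.

3SATC in turn reduces to 3SAT by replacing the literals of the disjunctions that are not selected by
positive literals over fresh variables, which does not change the length of the code. Finally, 3SAT
is in NP with a certificate that marks each occurrence of a literal with the value of its variable:
a finite automaton checks the clauses, and the marks of equal variables are compared pairwise.
-/

namespace NonuniformIS

open Turing

/-! ### Polynomially bounded functions -/

theorem monotone_eval {R : Type*} [Semiring R] [PartialOrder R] [CanonicallyOrderedAdd R]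
    [IsOrderedRing R] (p : Polynomial R) : Monotone fun x => p.eval x := by
  intro a b hab
  induction p using Polynomial.induction_on' with
  | add p q hp hq => simpa only [Polynomial.eval_add] using add_le_add hp hq
  | monomial n c =>
    simp only [Polynomial.eval_monomial]
    gcongr

/-- Functions bounded by a polynomial with natural coefficients. Membership in `poly` requires a
polynomial function; size bounds only ever need domination by one. -/
def PolyBound (f : ℕ → ℕ) : Prop := ∃ p : Polynomial ℕ, ∀ n, f n ≤ p.eval n

namespace PolyBound

variable {f g : ℕ → ℕ}

theorem mono (hg : PolyBound g) (h : ∀ n, f n ≤ g n) : PolyBound f :=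
  hg.imp fun _ hp n => (h n).trans (hp n)

theorem const (c : ℕ) : PolyBound fun _ => c :=
  ⟨Polynomial.C c, fun _ => Polynomial.eval_C.ge⟩

theorem id : PolyBound fun n => n :=
  ⟨Polynomial.X, fun _ => Polynomial.eval_X.ge⟩

theorem eval (p : Polynomial ℕ) : PolyBound fun n => p.eval n := ⟨p, fun _ => le_rfl⟩

theorem add (hf : PolyBound f) (hg : PolyBound g) : PolyBound fun n => f n + g n := by
  obtain ⟨⟨p, hp⟩, ⟨q, hq⟩⟩ := And.intro hf hg
  exact ⟨p + q, fun n => Polynomial.eval_add.ge.trans' (add_le_add (hp n) (hq n))⟩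

theorem mul (hf : PolyBound f) (hg : PolyBound g) : PolyBound fun n => f n * g n := by
  obtain ⟨⟨p, hp⟩, ⟨q, hq⟩⟩ := And.intro hf hg
  exact ⟨p * q, fun n => Polynomial.eval_mul.ge.trans' (Nat.mul_le_mul (hp n) (hq n))⟩

theorem pow (hf : PolyBound f) (k : ℕ) : PolyBound fun n => f n ^ k := by
  obtain ⟨p, hp⟩ := hf
  exact ⟨p ^ k, fun n => (Polynomial.eval_pow k).ge.trans' (Nat.pow_le_pow_left (hp n) k)⟩

theorem exists_monotone (hf : PolyBound f) :
    ∃ g : ℕ → ℕ, Monotone g ∧ PolyBound g ∧ ∀ n, f n ≤ g n := by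
  obtain ⟨p, hp⟩ := hf
  exact ⟨fun n => p.eval n, monotone_eval p, eval p, hp⟩

theorem comp (hf : PolyBound f) (hg : PolyBound g) : PolyBound fun n => f (g n) := by
  obtain ⟨⟨p, hp⟩, ⟨q, hq⟩⟩ := And.intro hf hg
  refine ⟨p.comp q, fun n => ?_⟩
  rw [Polynomial.eval_comp]
  exact (hp _).trans (monotone_eval p (hq n))

theorem exists_mem_poly (hf : PolyBound f) : ∃ h ∈ poly, ∀ n, f n ≤ h n := by
  obtain ⟨p, hp⟩ := hf
  refine ⟨fun n => p.eval n, ⟨p.map (Nat.castRingHom ℚ), fun n => ?_⟩, hp⟩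
  exact (Polynomial.eval_natCast_map (Nat.castRingHom ℚ) p n).symm

end PolyBound

theorem exists_eval_natCast_le (q : Polynomial ℚ) :
    ∃ r : Polynomial ℕ, ∀ n : ℕ, q.eval (n : ℚ) ≤ (r.eval n : ℕ) := by
  induction q using Polynomial.induction_on' with
  | add p q hp hq =>
    obtain ⟨⟨r, hr⟩, ⟨s, hs⟩⟩ := And.intro hp hq
    refine ⟨r + s, fun n => ?_⟩
    simpa only [Polynomial.eval_add, Nat.cast_add] using add_le_add (hr n) (hs n)
  | monomial m c =>
    refine ⟨Polynomial.monomial m ⌈c⌉₊, fun n => ?_⟩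
    simp only [Polynomial.eval_monomial, Nat.cast_mul, Nat.cast_pow]
    gcongr
    exact Nat.le_ceil c

theorem PolyBound.of_mem_poly {h : ℕ → ℕ} (hh : h ∈ poly) : PolyBound h := by
  obtain ⟨p, hp⟩ := hh
  obtain ⟨r, hr⟩ := exists_eval_natCast_le p
  exact ⟨r, fun n => by exact_mod_cast (hp n).le.trans (hr n)⟩

/-! ### Juntas -/

/-- `G` is an `m`-junta over the family `f`: at most `m` members of the family determine it. -/
def IsJunta {X ι : Type*} (m : ℕ) (f : ι → X → Bool) (G : X → Bool) : Prop :=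
  ∃ J : Finset ι, J.card ≤ m ∧ ∀ x y, (∀ j ∈ J, f j x = f j y) → G x = G y

namespace IsJunta

variable {X Y ι : Type*} {m : ℕ} {f : ι → X → Bool} {G : X → Bool}

theorem mono (h : IsJunta m f G) {k : ℕ} (hmk : m ≤ k) : IsJunta k f G :=
  h.imp fun _ hJ => ⟨hJ.1.trans hmk, hJ.2⟩

theorem of_forall_eq (h : ∀ x y, G x = G y) : IsJunta m f G :=
  ⟨∅, by simp, fun x y _ => h x y⟩

theorem of_apply (j : ι) (h : ∀ x y, f j x = f j y → G x = G y) : IsJunta 1 f G :=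
  ⟨{j}, by simp, fun x y hxy => h x y (hxy j (by simp))⟩

theorem map (h : IsJunta m f G) (φ : Bool → Bool) : IsJunta m f fun x => φ (G x) :=
  h.imp fun _ hJ => ⟨hJ.1, fun x y hxy => congrArg φ (hJ.2 x y hxy)⟩

theorem comp (h : IsJunta m f G) (φ : Y → X) :
    IsJunta m (fun j y => f j (φ y)) fun y => G (φ y) :=
  h.imp fun _ hJ => ⟨hJ.1, fun x y => hJ.2 (φ x) (φ y)⟩

end IsJunta

/-- Every bit of `π x` depends on at most one bit of `x`. -/
def IsProjection {n N : ℕ} (π : (Fin n → Bool) → Fin N → Bool) : Prop :=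
  ∀ i, IsJunta 1 (fun j x => x j) fun x => π x i

/-! ### Functions computed by small circuits -/

namespace Circuit

variable {n s : ℕ}

theorem le_size (C : Circuit n s) : n ≤ s := by
  induction C <;> omega

theorem eval_castLE (C : Circuit n s) (x : Fin n → Bool) (i : Fin n) :
    C.eval x (i.castLE C.le_size) = x i := by
  induction C with
  | inputs => rfl
  | snoc C g ih => exact (Fin.snoc_castSucc (α := fun _ => Bool) _ _ (i.castLE C.le_size)).trans ih

/-- Some node of the circuit computes `f`. -/
def Realizes (C : Circuit n s) (f : (Fin n → Bool) → Bool) : Prop :=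
  ∃ o, ∀ x, C.eval x o = f x

theorem Realizes.snoc {C : Circuit n s} {f : (Fin n → Bool) → Bool} (h : C.Realizes f)
    (g : Gate s) : (C.snoc g).Realizes f := by
  obtain ⟨o, ho⟩ := h
  exact ⟨o.castSucc, fun x => by simp [eval, ho]⟩

theorem realizes_snoc_last (C : Circuit n s) (g : Gate s) :
    (C.snoc g).Realizes fun x => g.eval (C.eval x) :=
  ⟨Fin.last s, fun x => by simp [eval]⟩

end Circuit

/-- Some circuit with at most `s` nodes computes all the functions in `F`. -/
def HasCircuit (n s : ℕ) (F : Set ((Fin n → Bool) → Bool)) : Prop :=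
  ∃ s' ≤ s, ∃ C : Circuit n s', ∀ f ∈ F, C.Realizes f

/-- A number of gates sufficient to compute any function of `m` nodes. -/
def juntaSize : ℕ → ℕ
  | 0 => 1
  | m + 1 => 2 * juntaSize m + 4

theorem juntaSize_mono : Monotone juntaSize :=
  monotone_nat_of_le_succ fun n => by simp only [juntaSize]; omega

namespace HasCircuit

variable {n s m : ℕ} {F : Set ((Fin n → Bool) → Bool)} {f g : (Fin n → Bool) → Bool}

theorem mono (h : HasCircuit n s F) {t : ℕ} (hst : s ≤ t) {G : Set ((Fin n → Bool) → Bool)}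
    (hG : G ⊆ F) : HasCircuit n t G := by
  obtain ⟨s', hs', C, hC⟩ := h
  exact ⟨s', hs'.trans hst, C, fun f hf => hC f (hG hf)⟩

theorem inputs (n : ℕ) : HasCircuit n n (Set.range fun (i : Fin n) x => x i) :=
  ⟨n, le_rfl, .inputs, Set.forall_mem_range.2 fun i => ⟨i, fun _ => rfl⟩⟩

theorem insert_gate (h : HasCircuit n s F)
    (hf : ∀ {s'} (C : Circuit n s'), (∀ k ∈ F, C.Realizes k) →
      ∃ g : Gate s', ∀ x, g.eval (C.eval x) = f x) :
    HasCircuit n (s + 1) (insert f F) := by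
  obtain ⟨s', hs', C, hC⟩ := h
  obtain ⟨g, hg⟩ := hf C hC
  refine ⟨s' + 1, by omega, C.snoc g, Set.forall_mem_insert.2 ⟨?_, fun k hk => (hC k hk).snoc g⟩⟩
  simpa only [hg] using C.realizes_snoc_last g

theorem const (h : HasCircuit n s F) (b : Bool) : HasCircuit n (s + 1) (insert (fun _ => b) F) :=
  h.insert_gate fun _ _ => ⟨.const b, fun _ => rfl⟩

theorem not (h : HasCircuit n s F) (hf : f ∈ F) :
    HasCircuit n (s + 1) (insert (fun x => !(f x)) F) :=
  h.insert_gate fun C hC => by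
    obtain ⟨i, hi⟩ := hC f hf
    exact ⟨.not i, fun x => by simp only [Gate.eval, hi]⟩

theorem and (h : HasCircuit n s F) (hf : f ∈ F) (hg : g ∈ F) :
    HasCircuit n (s + 1) (insert (fun x => f x && g x) F) :=
  h.insert_gate fun C hC => by
    obtain ⟨⟨i, hi⟩, ⟨j, hj⟩⟩ := And.intro (hC f hf) (hC g hg)
    exact ⟨.and i j, fun x => by simp only [Gate.eval, hi, hj]⟩

theorem or (h : HasCircuit n s F) (hf : f ∈ F) (hg : g ∈ F) :
    HasCircuit n (s + 1) (insert (fun x => f x || g x) F) :=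
  h.insert_gate fun C hC => by
    obtain ⟨⟨i, hi⟩, ⟨j, hj⟩⟩ := And.intro (hC f hf) (hC g hg)
    exact ⟨.or i j, fun x => by simp only [Gate.eval, hi, hj]⟩

theorem cond (h : HasCircuit n s F) {c : (Fin n → Bool) → Bool} (hc : c ∈ F) (hf : f ∈ F)
    (hg : g ∈ F) : HasCircuit n (s + 4) (insert (fun x => bif c x then f x else g x) F) := by
  have h₁ := h.and hc hf
  have h₂ := h₁.not (f := c) (.inr hc)
  have h₃ := h₂.and (f := fun x => !(c x)) (g := g) (.inl rfl) (.inr (.inr hg))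
  have h₄ := h₃.or (f := fun x => c x && f x) (g := fun x => !(c x) && g x) (.inr (.inr (.inl rfl)))
    (.inl rfl)
  refine h₄.mono le_rfl (Set.insert_subset (.inl ?_) fun k hk => .inr (.inr (.inr (.inr hk))))
  funext x
  cases c x <;> simp only [cond_true, cond_false, Bool.true_and, Bool.false_and,
    Bool.not_true, Bool.not_false, Bool.or_false, Bool.false_or]

theorem insert_comp_list (fs : List ((Fin n → Bool) → Bool)) (g : List Bool → Bool)
    (h : HasCircuit n s F) (hfs : ∀ f ∈ fs, f ∈ F) :
    HasCircuit n (s + juntaSize fs.length) (insert (fun x => g (fs.map fun f => f x)) F) := by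
  induction fs generalizing g s F with
  | nil => exact h.const (g [])
  | cons f fs ih =>
    -- Shannon expansion with respect to the first function
    obtain ⟨hf, hfs⟩ := List.forall_mem_cons.1 hfs
    have h₁ := ih (fun l => g (true :: l)) h hfs
    have h₀ := ih (fun l => g (false :: l)) h₁ fun f hf => .inr (hfs f hf)
    have hc := h₀.cond (c := f) (.inr (.inr hf)) (.inr (.inl rfl)) (.inl rfl)
    refine hc.mono (by simp only [List.length_cons, juntaSize]; omega)
      (Set.insert_subset (.inl ?_) fun k hk => .inr (.inr (.inr hk)))
    funext x
    cases hx : f x <;> simp only [List.map_cons, hx, cond_true, cond_false]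

theorem insert_junta {ι : Type*} {f : ι → (Fin n → Bool) → Bool} (h : HasCircuit n s F)
    (hf : ∀ j, f j ∈ F) (hg : IsJunta m f g) : HasCircuit n (s + juntaSize m) (insert g F) := by
  obtain ⟨J, hJ, hg⟩ := hg
  let values : (Fin n → Bool) → List Bool := fun x => (J.toList.map f).map fun k => k x
  have hfac : g.FactorsThrough values := fun x y hxy => hg x y fun j hj => by
    simp only [values, List.map_map, List.map_inj_left, Function.comp_apply] at hxy
    exact hxy j (J.mem_toList.2 hj)
  have hlist := h.insert_comp_list (J.toList.map f) (Function.extend values g fun _ => false)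
    (List.forall_mem_map.2 fun j _ => hf j)
  refine hlist.mono ?_ (Set.insert_subset (.inl ?_) (Set.subset_insert _ _))
  · simpa only [List.length_map, Finset.length_toList, add_le_add_iff_left] using juntaSize_mono hJ
  · exact funext fun x => (hfac.extend_apply _ x).symm

theorem union_juntas {ι κ : Type*} {f : ι → (Fin n → Bool) → Bool} (h : HasCircuit n s F)
    (hf : ∀ j, f j ∈ F) (P : Finset κ) {G : κ → (Fin n → Bool) → Bool}
    (hG : ∀ p ∈ P, IsJunta m f (G p)) :
    HasCircuit n (s + P.card * juntaSize m) (F ∪ G '' P) := by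
  classical
  induction P using Finset.induction_on with
  | empty => simpa using h
  | insert p P hp ih =>
    obtain ⟨hGp, hGP⟩ := Finset.forall_mem_insert .. |>.1 hG
    refine ((ih hGP).insert_junta (fun j => .inl (hf j)) hGp).mono ?_ ?_
    · rw [Finset.card_insert_of_notMem hp]
      linarith
    · rw [Finset.coe_insert, Set.image_insert_eq, Set.union_insert]

theorem range_of_juntas {ι κ : Type*} [Fintype κ] {f : ι → (Fin n → Bool) → Bool}
    (h : HasCircuit n s (Set.range f)) {G : κ → (Fin n → Bool) → Bool}
    (hG : ∀ p, IsJunta m f (G p)) :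
    HasCircuit n (s + Fintype.card κ * juntaSize m) (Set.range G) :=
  (h.union_juntas (fun j => ⟨j, rfl⟩) Finset.univ fun p _ => hG p).mono le_rfl <| by
    rw [Finset.coe_univ, Set.image_univ]
    exact Set.subset_union_right

theorem tableau {ι : Type*} [Fintype ι] (T : ℕ → ι → (Fin n → Bool) → Bool) (t : ℕ)
    (hinit : ∀ p, IsJunta m (fun j x => x j) (T 0 p))
    (hstep : ∀ i < t, ∀ p, IsJunta m (T i) (T (i + 1) p)) :
    HasCircuit n (n + (t + 1) * (Fintype.card ι * juntaSize m)) (Set.range (T t)) := by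
  induction t with
  | zero => exact ((inputs n).range_of_juntas hinit).mono (by simp) le_rfl
  | succ t ih =>
    have hprev := ih fun i hi => hstep i (Nat.lt_succ_of_lt hi)
    exact (hprev.range_of_juntas (hstep t (Nat.lt_succ_self t))).mono (by linarith) le_rfl

theorem subst {N S : ℕ} (C : Circuit N S) {π : (Fin n → Bool) → Fin N → Bool}
    (h : HasCircuit n s (Set.range fun i x => π x i)) :
    HasCircuit n (s + S) (Set.range fun (o : Fin S) x => C.eval (π x) o) := by
  induction C with
  | inputs => exact h.mono (by omega) le_rfl
  | @snoc S C g ih =>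
    refine (ih.insert_gate (f := fun x => g.eval (C.eval (π x))) fun D hD => ?_).mono
      (by omega) ?_
    · choose node hnode using fun o => hD _ ⟨o, rfl⟩
      refine ⟨match g with
        | .const b => .const b
        | .not i => .not (node i)
        | .and i j => .and (node i) (node j)
        | .or i j => .or (node i) (node j), fun x => ?_⟩
      cases g <;> simp only [Gate.eval, hnode]
    · rintro _ ⟨o, rfl⟩
      refine Fin.lastCases (.inl ?_) (fun o => .inr ⟨o, ?_⟩) o
      all_goals simp only [Circuit.eval, Fin.snoc_last, Fin.snoc_castSucc]

theorem comp_projection {N S : ℕ} {f : (Fin N → Bool) → Bool} (h : HasCircuit N S {f})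
    {π : (Fin n → Bool) → Fin N → Bool} (hπ : IsProjection π) :
    HasCircuit n (n + N * juntaSize 1 + S) {fun x => f (π x)} := by
  obtain ⟨S', hS', C, hC⟩ := h
  obtain ⟨o, ho⟩ := hC f rfl
  refine (subst C ((inputs n).range_of_juntas hπ)).mono (by simpa using hS') ?_
  rintro _ rfl
  exact ⟨o, by simp only [ho]⟩

end HasCircuit

/-! ### Families of polynomial circuit size -/

/-- Boolean function families computed by polynomial-size circuits: the analogue of `PPoly` for
families. -/
def PolySize : Set BoolFunFamily :=
  {f | ∃ h : ℕ → ℕ, PolyBound h ∧ ∀ n, HasCircuit n (h n) {f n}}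

theorem mem_PolySize_of_projection {f g : BoolFunFamily} (hg : g ∈ PolySize) {N : ℕ → ℕ}
    (hN : PolyBound N) (h : ∀ n, ∃ M ≤ N n, ∃ π : (Fin n → Bool) → Fin M → Bool,
      IsProjection π ∧ ∀ x, f n x = g M (π x)) :
    f ∈ PolySize := by
  obtain ⟨size, hsize, hcirc⟩ := hg
  obtain ⟨bound, hmono, hbound, hle⟩ := hsize.exists_monotone
  refine ⟨fun n => n + N n * juntaSize 1 + bound (N n),
    (PolyBound.id.add (hN.mul (.const _))).add (hbound.comp hN), fun n => ?_⟩
  obtain ⟨M, hM, π, hπ, hfg⟩ := h n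
  rw [funext hfg]
  refine ((hcirc M).comp_projection hπ).mono ?_ le_rfl
  have hsize : size M ≤ bound (N n) := (hle M).trans (hmono hM)
  change n + M * juntaSize 1 + size M ≤ n + N n * juntaSize 1 + bound (N n)
  gcongr

open Classical in
/-- The family of the characteristic functions of a language on the words of each length. -/
noncomputable def charFamily (L : Language Bool) : BoolFunFamily := fun _ x =>
  decide (List.ofFn x ∈ L)

theorem charFamily_eq_true_iff {L : Language Bool} {n : ℕ} {x : Fin n → Bool} :
    charFamily L n x = true ↔ List.ofFn x ∈ L := by
  simp only [charFamily, decide_eq_true_eq]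

theorem mem_PPoly_iff {L : Language Bool} : L ∈ PPoly ↔ charFamily L ∈ PolySize := by
  have hchar : ∀ (n : ℕ) (x : Fin n → Bool) (b : Bool),
      b = charFamily L n x ↔ (b = true ↔ List.ofFn x ∈ L) := fun n x b => by
    rw [Bool.eq_iff_iff, charFamily_eq_true_iff]
  constructor
  · rintro ⟨h, hh, H⟩
    refine ⟨h, .of_mem_poly hh, fun n => ?_⟩
    obtain ⟨s, hs, C, o, hC⟩ := H n
    exact ⟨s, hs, C, by rintro _ rfl; exact ⟨o, fun x => (hchar n x _).2 (hC x)⟩⟩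
  · rintro ⟨h, hh, H⟩
    obtain ⟨h', hh', hle⟩ := hh.exists_mem_poly
    refine ⟨h', hh', fun n => ?_⟩
    obtain ⟨s, hs, C, hC⟩ := H n
    obtain ⟨o, ho⟩ := hC _ rfl
    exact ⟨s, hs.trans (hle n), C, o, fun x => (hchar n x _).1 (ho x)⟩

/-! ### Runs of threads on Boolean registers -/

/-- Contents of the registers; `none` marks a register that is not available. -/
abbrev RegState : Type := Focus → Option Bool

/-- The content of a register, by default `false`. -/
def RegState.bit (ρ : RegState) (f : Focus) : Bool := (ρ f).getD false

/-- The reply to a basic instruction whose register is available in `ρ`. -/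
def BasicInstr.reply (ρ : RegState) : BasicInstr → Bool
  | ⟨_, .set b⟩ => b
  | ⟨f, .get⟩ => ρ.bit f

/-- The contents of the registers after a basic instruction whose register is available in `ρ`. -/
def BasicInstr.effect (ρ : RegState) : BasicInstr → RegState
  | ⟨f, .set b⟩ => Function.update ρ f (some b)
  | ⟨_, .get⟩ => ρ

/-- The final content of the output register when the thread acts on registers with contents `ρ`;
`none` if the thread does not terminate or needs a register that is not available. It merges the
use and apply operators for all registers into a single evaluation. -/
def Thread.run : Thread → RegState → Option Bool
  | .inaction, _ => none
  | .terminated, ρ => ρ .out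
  | .tau p, ρ => p.run ρ
  | .pcc p a q, ρ =>
    if (ρ a.focus).isSome then
      bif a.reply ρ then p.run (a.effect ρ) else q.run (a.effect ρ)
    else none

theorem Thread.run_use {f : Focus} (hf : f ≠ .out) (p : Thread) (b : Bool) (ρ : RegState) :
    (p.use f (.reg b)).run ρ = p.run (Function.update ρ f (some b)) := by
  induction p generalizing b ρ with
  | inaction => rfl
  | terminated => simp only [use, run, Function.update_of_ne hf.symm]
  | tau _ ih => exact ih b ρ
  | pcc p a q ihp ihq =>
    obtain ⟨g, m⟩ := a
    by_cases hg : g = f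
    · subst hg
      rcases m with (_ | _) | _ <;> cases b <;>
        simp [use, run, BasicInstr.reply, BasicInstr.effect, RegState.bit, Service.reply,
          Service.derive, ihp, ihq]
    · cases m <;>
        simp [use, run, BasicInstr.reply, BasicInstr.effect, RegState.bit, hg, ihp, ihq,
          Function.update_comm hg]

/-- The output register with content `b`, or the empty service if the run has no result. -/
def Service.ofOption : Option Bool → Service
  | none => .empty
  | some b => .reg b

theorem Service.ofOption_eq_reg {o : Option Bool} {b : Bool} :
    Service.ofOption o = .reg b ↔ o = some b := by
  cases o <;> simp [Service.ofOption]

theorem Thread.apply_out (p : Thread) (b : Bool) :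
    p.apply .out (.reg b) =
      Service.ofOption (p.run (Function.update (fun _ => none) .out (some b))) := by
  induction p generalizing b with
  | inaction => rfl
  | terminated => simp [apply, run, Service.ofOption]
  | tau _ ih => exact ih b
  | pcc p a q ihp ihq =>
    obtain ⟨g, m⟩ := a
    by_cases hg : g = .out
    · subst hg
      rcases m with (_ | _) | _ <;> cases b <;>
        simp [apply, run, BasicInstr.reply, BasicInstr.effect, RegState.bit, Service.reply,
          Service.derive, ihp, ihq]
    · simp [apply, run, hg, Service.ofOption]

theorem Thread.run_foldl_use {ι : Type*} (L : List ι) {f : ι → Focus} (hf : ∀ i, f i ≠ .out)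
    (b : ι → Bool) (p : Thread) (ρ : RegState) :
    (L.foldl (fun p i => p.use (f i) (.reg (b i))) p).run ρ =
      p.run (L.foldr (fun i ρ => Function.update ρ (f i) (some (b i))) ρ) := by
  induction L generalizing p with
  | nil => rfl
  | cons i L ih => simp only [List.foldl_cons, ih, Thread.run_use (hf i), List.foldr_cons]

section FoldrUpdate

variable {ι α β : Type*} [DecidableEq α] {L : List ι} {f : ι → α} (v : ι → β) (ρ : α → β)

theorem foldr_update_apply_of_mem (hf : f.Injective) {i : ι} (hi : i ∈ L) :
    L.foldr (fun i ρ => Function.update ρ (f i) (v i)) ρ (f i) = v i := by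
  induction L with
  | nil => cases hi
  | cons j L ih =>
    by_cases hij : i = j
    · simp only [List.foldr_cons, hij, Function.update_self]
    · rw [List.foldr_cons, Function.update_of_ne (hf.ne hij)]
      exact ih ((List.mem_cons.1 hi).resolve_left hij)

theorem foldr_update_apply_of_notMem {a : α} (ha : ∀ i ∈ L, a ≠ f i) :
    L.foldr (fun i ρ => Function.update ρ (f i) (v i)) ρ a = ρ a := by
  induction L with
  | nil => rfl
  | cons j L ih =>
    obtain ⟨haj, haL⟩ := List.forall_mem_cons.1 ha
    rw [List.foldr_cons, Function.update_of_ne haj, ih haL]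

end FoldrUpdate

/-- The initial contents of the registers: `l` auxiliary registers and the output register contain
`false`, the input registers contain `b`. -/
def initRegs (l : ℕ) {n : ℕ} (b : Fin n → Bool) : RegState
  | .inp i => if h : i < n then some (b ⟨i, h⟩) else none
  | .aux i => if i < l then some false else none
  | .out => some false

theorem foldr_update_eq_initRegs (l : ℕ) {n : ℕ} (b : Fin n → Bool) :
    (List.range l).foldr (fun i ρ => Function.update ρ (Focus.aux i) (some false))
      ((List.finRange n).foldr (fun (i : Fin n) ρ => Function.update ρ (Focus.inp i) (some (b i)))
        (Function.update (fun _ => none) Focus.out (some false))) = initRegs l b := by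
  have haux : Function.Injective Focus.aux := fun _ _ h => Focus.aux.inj h
  have hinp : Function.Injective fun i : Fin n => Focus.inp i :=
    fun _ _ h => Fin.ext (Focus.inp.inj h)
  funext g
  cases g with
  | inp i =>
    rw [foldr_update_apply_of_notMem _ _ (by simp)]
    by_cases hi : i < n
    · rw [initRegs, dif_pos hi]
      exact foldr_update_apply_of_mem _ _ hinp (List.mem_finRange ⟨i, hi⟩)
    · rw [foldr_update_apply_of_notMem _ _ fun j _ h => hi ((Focus.inp.inj h).trans_lt j.2),
        initRegs, dif_neg hi]
      rfl
  | aux i =>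
    by_cases hi : i < l
    · rw [foldr_update_apply_of_mem _ _ haux (List.mem_range.2 hi), initRegs, if_pos hi]
    · rw [foldr_update_apply_of_notMem _ _ fun j hj h =>
          hi ((Focus.aux.inj h).trans_lt (List.mem_range.1 hj)),
        foldr_update_apply_of_notMem _ _ (by simp), initRegs, if_neg hi]
      rfl
  | out =>
    rw [foldr_update_apply_of_notMem _ _ (by simp), foldr_update_apply_of_notMem _ _ (by simp)]
    rfl

theorem computes_iff {n : ℕ} {X : List PrimInstr} {f : (Fin n → Bool) → Bool} :
    Computes X f ↔ ∃ l : ℕ, ∀ b, (extract X).run (initRegs l b) = some (f b) := by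
  refine exists_congr fun l => forall_congr' fun b => ?_
  dsimp only
  rw [Thread.apply_out, Service.ofOption_eq_reg, ← foldr_update_eq_initRegs,
    Thread.run_foldl_use _ (f := fun i : Fin n => .inp i) (by simp),
    Thread.run_foldl_use _ (f := .aux) (by simp) fun _ => false]

/-! ### From instruction sequences to circuits -/

namespace PrimInstr

/-- The basic instruction of a primitive instruction, if any. -/
def basic : PrimInstr → Option BasicInstr
  | .plain a | .posTest a | .negTest a => some a
  | .jump _ | .halt => none

/-- The focus of a primitive instruction, by default the output register. -/
def focus (u : PrimInstr) : Focus := u.basic.elim .out BasicInstr.focus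

/-- The reply to the basic instruction of a primitive instruction, by default `false`. -/
def reply (u : PrimInstr) (ρ : RegState) : Bool := u.basic.elim false (BasicInstr.reply ρ)

/-- The contents of the registers after a primitive instruction. -/
def effect (u : PrimInstr) (ρ : RegState) : RegState := u.basic.elim ρ (BasicInstr.effect ρ)

/-- The number of instructions skipped after a primitive instruction to which the reply is `r`.
The value is irrelevant for `#0` and `!`, after which nothing is executed. -/
def skip (r : Bool) : PrimInstr → ℕ
  | .plain _ | .halt => 0
  | .posTest _ => bif r then 0 else 1
  | .negTest _ => bif r then 1 else 0
  | .jump l => l - 1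

theorem run_extract_cons {u : PrimInstr} {Y : List PrimInstr} {ρ : RegState} {v : Bool}
    (h : (extract (u :: Y)).run ρ = some v) :
    u = .halt ∧ ρ .out = some v ∨
      u ≠ .halt ∧ (extract (Y.drop (u.skip (u.reply ρ)))).run (u.effect ρ) = some v := by
  rcases u with a | a | a | (_ | l) | _
  case jump.zero => simp [extract, Thread.run] at h
  case jump.succ => exact .inr ⟨by simp, by simpa [extract, skip, effect, basic] using h⟩
  case halt => exact .inl ⟨rfl, by simpa [extract, Thread.run] using h⟩
  all_goals
    refine .inr ⟨by simp, ?_⟩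
    simp only [extract, Thread.run, Option.ite_none_right_eq_some] at h
    cases hr : a.reply ρ <;> simpa [skip, reply, effect, basic, hr] using h.2

theorem reply_congr {u : PrimInstr} {ρ ρ' : RegState} (h : ρ.bit u.focus = ρ'.bit u.focus) :
    u.reply ρ = u.reply ρ' := by
  unfold reply
  unfold focus at h
  generalize u.basic = a at h ⊢
  rcases a with _ | ⟨f, b | _⟩
  exacts [rfl, rfl, h]

theorem bit_effect_congr (u : PrimInstr) {ρ ρ' : RegState} {f : Focus} (h : ρ.bit f = ρ'.bit f) :
    (u.effect ρ).bit f = (u.effect ρ').bit f := by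
  unfold effect
  rcases u.basic with _ | ⟨g, b | _⟩
  · exact h
  · by_cases hfg : f = g
    · simp only [hfg, Option.elim, BasicInstr.effect, RegState.bit, Function.update_self]
    · simpa only [Option.elim, BasicInstr.effect, RegState.bit, Function.update_of_ne hfg] using h
  · exact h

open Classical in
/-- The position that follows position `t`, where `e` stands for the end of the execution. -/
noncomputable def nextPos (u : PrimInstr) (e t : ℕ) (r : Bool) : ℕ :=
  if u = .halt then e else t + 1 + u.skip r

/-- Execution of the instruction at position `t` in case position `t` is pending: a configuration
consists of the pending position and the contents of the registers. -/
noncomputable def execAt (u : PrimInstr) (e t : ℕ) (c : ℕ × RegState) : ℕ × RegState :=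
  if c.1 = t then (u.nextPos e t (u.reply c.2), u.effect c.2) else c

end PrimInstr

/-- The configuration after the positions below `t` have been handled. As jumps go forward, every
instruction is executed at most once, so that a single pass suffices. -/
noncomputable def scan (X : List PrimInstr) (ρ : RegState) : ℕ → ℕ × RegState
  | 0 => (0, ρ)
  | t + 1 => X[t]?.elim (scan X ρ t) fun u => u.execAt X.length t (scan X ρ t)

section Scan

variable {X : List PrimInstr} {ρ : RegState}

theorem scan_succ {t : ℕ} (ht : t < X.length) :
    scan X ρ (t + 1) = X[t].execAt X.length t (scan X ρ t) := by
  rw [scan, List.getElem?_eq_getElem ht, Option.elim]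

theorem le_scan {t : ℕ} (ht : t ≤ X.length) : t ≤ (scan X ρ t).1 := by
  induction t with
  | zero => exact Nat.zero_le _
  | succ t ih =>
    have hle := ih (Nat.le_of_succ_le ht)
    rw [scan_succ ht, PrimInstr.execAt]
    split_ifs with hpos
    · rw [PrimInstr.nextPos]
      split_ifs
      exacts [ht, Nat.le_add_right _ _]
    · exact Nat.lt_of_le_of_ne hle (Ne.symm hpos)

theorem run_scan_or {v : Bool} (h : (extract X).run ρ = some v) {t : ℕ} (ht : t ≤ X.length) :
    (extract (X.drop (scan X ρ t).1)).run (scan X ρ t).2 = some v ∨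
      (scan X ρ t).1 = X.length ∧ (scan X ρ t).2 .out = some v := by
  induction t with
  | zero => exact .inl h
  | succ t ih =>
    rw [scan_succ ht, PrimInstr.execAt]
    split_ifs with hpos
    · rcases ih (Nat.le_of_succ_le ht) with hrun | ⟨hend, -⟩
      · rw [hpos, List.drop_eq_getElem_cons ht] at hrun
        rcases PrimInstr.run_extract_cons hrun with ⟨hhalt, hout⟩ | ⟨hhalt, hrest⟩
        · refine .inr ⟨if_pos hhalt, ?_⟩
          rw [hhalt]
          exact hout
        · left
          rwa [List.drop_drop, ← (if_neg hhalt : PrimInstr.nextPos _ X.length _ _ = _)] at hrest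
      · omega
    · exact ih (Nat.le_of_succ_le ht)

theorem scan_length_out {v : Bool} (h : (extract X).run ρ = some v) :
    (scan X ρ X.length).2 .out = some v := by
  rcases run_scan_or h le_rfl with hrun | ⟨-, hout⟩
  · rw [List.drop_eq_nil_of_le (le_scan le_rfl)] at hrun
    simp [extract, Thread.run] at hrun
  · exact hout

end Scan

/-- The registers whose contents matter during the execution: the output register and the foci of
the instructions. -/
def relevantFocus (X : List PrimInstr) (o : Option (Fin X.length)) : Focus :=
  o.elim .out fun i => X[i].focus

/-- The bits of a configuration that a circuit keeps track of: the pending position in unary and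
the contents of the relevant registers. -/
def scanBit (X : List PrimInstr) : Fin X.length ⊕ Option (Fin X.length) → ℕ × RegState → Bool
  | .inl i, c => decide (c.1 = i)
  | .inr o, c => c.2.bit (relevantFocus X o)

theorem isJunta_bit_initRegs (l n : ℕ) (f : Focus) :
    IsJunta 1 (fun j x => x j) fun x : Fin n → Bool => (initRegs l x).bit f := by
  rcases f with i | i | _
  case inp =>
    by_cases hi : i < n
    · refine .of_apply ⟨i, hi⟩ fun x y hxy => ?_
      simpa only [RegState.bit, initRegs, hi, dif_pos, Option.getD_some] using hxy
    · exact .of_forall_eq fun x y => by simp only [RegState.bit, initRegs, dif_neg hi]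
  all_goals exact .of_forall_eq fun _ _ => rfl

theorem isJunta_scanBit_execAt {X : List PrimInstr} {t : ℕ} (ht : t < X.length)
    (p : Fin X.length ⊕ Option (Fin X.length)) :
    IsJunta 3 (scanBit X) fun c => scanBit X p (X[t].execAt X.length t c) := by
  classical
  refine ⟨{.inl ⟨t, ht⟩, .inr (some ⟨t, ht⟩), p}, Finset.card_le_three, fun c c' hcc' => ?_⟩
  have hpos : c.1 = t ↔ c'.1 = t := decide_eq_decide.1 (hcc' (.inl ⟨t, ht⟩) (by simp))
  have hreply : X[t].reply c.2 = X[t].reply c'.2 :=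
    PrimInstr.reply_congr (hcc' (.inr (some ⟨t, ht⟩)) (by simp))
  have hbit : scanBit X p c = scanBit X p c' := hcc' p (by simp)
  simp only [PrimInstr.execAt]
  by_cases hc : c.1 = t
  · rw [if_pos hc, if_pos (hpos.1 hc), hreply]
    rcases p with i | o
    exacts [rfl, X[t].bit_effect_congr hbit]
  · rwa [if_neg hc, if_neg (mt hpos.2 hc)]

theorem Computes.hasCircuit {n : ℕ} {X : List PrimInstr} {f : (Fin n → Bool) → Bool}
    (h : Computes X f) :
    HasCircuit n (n + (X.length + 1) * ((2 * X.length + 1) * juntaSize 3)) {f} := by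
  obtain ⟨l, hl⟩ := computes_iff.1 h
  let T := fun t p (x : Fin n → Bool) => scanBit X p (scan X (initRegs l x) t)
  have hinit : ∀ p, IsJunta 3 (fun j x => x j) (T 0 p) := by
    rintro (i | o)
    exacts [.of_forall_eq fun _ _ => rfl, (isJunta_bit_initRegs l n _).mono (by norm_num)]
  have hstep : ∀ t < X.length, ∀ p, IsJunta 3 (T t) (T (t + 1) p) := fun t ht p => by
    simpa only [T, scan_succ ht] using
      (isJunta_scanBit_execAt ht p).comp fun x => scan X (initRegs l x) t
  refine (HasCircuit.tableau T X.length hinit hstep).mono (le_of_eq ?_) ?_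
  · simp only [Fintype.card_sum, Fintype.card_fin, Fintype.card_option]
    ring
  · rintro _ rfl
    refine ⟨.inr none, funext fun x => ?_⟩
    simp only [T, scanBit, relevantFocus, Option.elim, RegState.bit, scan_length_out (hl x),
      Option.getD_some]

/-! ### From circuits to instruction sequences -/

/-- The register holding the value of node `i` of a circuit with `n` inputs. -/
def nodeFocus (n i : ℕ) : Focus := if i < n then .inp i else .aux i

/-- Code storing the value of a gate in the auxiliary register with number `s`, which must initially
contain `false`. -/
def gateCode (n : ℕ) {s : ℕ} : Gate s → List PrimInstr
  | .const b => [.plain ⟨.aux s, .set b⟩]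
  | .not i => [.negTest ⟨nodeFocus n i, .get⟩, .plain ⟨.aux s, .set true⟩]
  | .and i j => [.negTest ⟨nodeFocus n i, .get⟩, .jump 3, .posTest ⟨nodeFocus n j, .get⟩,
      .plain ⟨.aux s, .set true⟩]
  | .or i j => [.posTest ⟨nodeFocus n i, .get⟩, .jump 2, .posTest ⟨nodeFocus n j, .get⟩,
      .plain ⟨.aux s, .set true⟩]

/-- Code storing the values of all gates of a circuit in auxiliary registers. -/
def circuitCode {n : ℕ} : {s : ℕ} → Circuit n s → List PrimInstr
  | _, .inputs => []
  | _, .snoc C g => circuitCode C ++ gateCode n g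

/-- Code copying the value of node `o` to the output register. -/
def outputCode (n o : ℕ) : List PrimInstr :=
  [.posTest ⟨nodeFocus n o, .get⟩, .plain ⟨.out, .set true⟩, .halt]

theorem nodeFocus_ne_aux {n s i : ℕ} (hi : i < s) : nodeFocus n i ≠ .aux s := by
  unfold nodeFocus
  split_ifs
  exacts [Focus.noConfusion, fun h => hi.ne (Focus.aux.inj h)]

theorem run_gateCode (n : ℕ) {s : ℕ} (g : Gate s) (Y : List PrimInstr) {ρ : RegState}
    {v : Fin s → Bool} (hv : ∀ i : Fin s, ρ (nodeFocus n i) = some (v i))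
    (hs : ρ (.aux s) = some false) :
    (extract (gateCode n g ++ Y)).run ρ =
      (extract Y).run (Function.update ρ (.aux s) (some (g.eval v))) := by
  have hup : Function.update ρ (.aux s) (some false) = ρ := by simp [← hs]
  cases g with
  | const b =>
    cases b <;> simp [gateCode, extract, Thread.run, BasicInstr.reply, BasicInstr.effect, hs,
      Gate.eval]
  | not i =>
    cases hi : v i <;> simp [gateCode, extract, Thread.run, BasicInstr.reply, BasicInstr.effect,
      RegState.bit, hs, Gate.eval, hv, hi, hup]
  | and i j | or i j =>
    cases hi : v i <;> cases hj : v j <;> simp [gateCode, extract, Thread.run, BasicInstr.reply,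
      BasicInstr.effect, RegState.bit, hs, Gate.eval, hv, hi, hj, hup]

theorem run_circuitCode {n s : ℕ} (C : Circuit n s) {l : ℕ} (hl : s ≤ l) (x : Fin n → Bool) :
    ∃ ρ : RegState, ρ .out = some false ∧
      (∀ i : Fin s, ρ (nodeFocus n i) = some (C.eval x i)) ∧
      (∀ j, s ≤ j → j < l → ρ (.aux j) = some false) ∧
      ∀ Y, (extract (circuitCode C ++ Y)).run (initRegs l x) = (extract Y).run ρ := by
  induction C with
  | inputs =>
    exact ⟨initRegs l x, rfl, fun i => by simp [nodeFocus, initRegs, Circuit.eval],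
      fun j _ hj => by simp [initRegs, hj], fun Y => rfl⟩
  | @snoc s C g ih =>
    obtain ⟨ρ, hout, hnodes, hfree, hrun⟩ := ih (by omega)
    refine ⟨Function.update ρ (.aux s) (some (g.eval (C.eval x))), by simp [hout], fun i => ?_,
      fun j hj hjl => ?_, fun Y => ?_⟩
    · refine Fin.lastCases ?_ (fun i => ?_) i
      · simp [nodeFocus, Circuit.eval, not_lt.2 C.le_size]
      · simp [Function.update_of_ne (nodeFocus_ne_aux i.2), hnodes, Circuit.eval]
    · have hjs : Focus.aux j ≠ .aux s := fun h => by have := Focus.aux.inj h; omega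
      rw [Function.update_of_ne hjs]
      exact hfree j (by omega) hjl
    · rw [circuitCode, List.append_assoc, hrun]
      exact run_gateCode n g Y hnodes (hfree s le_rfl (by omega))

theorem run_outputCode {n o : ℕ} {ρ : RegState} {b : Bool} (hout : ρ .out = some false)
    (ho : ρ (nodeFocus n o) = some b) : (extract (outputCode n o)).run ρ = some b := by
  cases b <;> simp [outputCode, extract, Thread.run, BasicInstr.reply, BasicInstr.effect,
    RegState.bit, ho, hout]

theorem length_circuitCode_le {n s : ℕ} (C : Circuit n s) : (circuitCode C).length ≤ 4 * s := by
  induction C with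
  | inputs => simp [circuitCode]
  | snoc C g ih =>
    have hgate : (gateCode n g).length ≤ 4 := by cases g <;> simp [gateCode]
    rw [circuitCode, List.length_append]
    omega

theorem isAllowed_get_nodeFocus (n i : ℕ) : (BasicInstr.mk (nodeFocus n i) .get).IsAllowed := by
  unfold nodeFocus
  split_ifs <;> trivial

theorem isAllowed_circuitCode {n s : ℕ} (C : Circuit n s) : ∀ u ∈ circuitCode C, u.IsAllowed := by
  induction C with
  | inputs => simp [circuitCode]
  | snoc C g ih =>
    refine List.forall_mem_append.2 ⟨ih, ?_⟩
    have hset : ∀ i b, (BasicInstr.mk (.aux i) (.set b)).IsAllowed := fun _ _ => trivial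
    cases g <;> simp only [gateCode, List.forall_mem_cons, PrimInstr.IsAllowed,
      isAllowed_get_nodeFocus, hset, List.not_mem_nil, IsEmpty.forall_iff, implies_true, and_self]

theorem isAllowed_outputCode (n o : ℕ) : ∀ u ∈ outputCode n o, u.IsAllowed := by
  have hset : ∀ b, (BasicInstr.mk .out (.set b)).IsAllowed := fun _ => trivial
  simp only [outputCode, List.forall_mem_cons, PrimInstr.IsAllowed, isAllowed_get_nodeFocus, hset,
    List.not_mem_nil, IsEmpty.forall_iff, implies_true, and_self]

theorem HasCircuit.exists_computes {n s : ℕ} {f : (Fin n → Bool) → Bool}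
    (h : HasCircuit n s {f}) : ∃ X ∈ ISbr, Computes X f ∧ X.length ≤ 4 * s + 3 := by
  obtain ⟨s', hs', C, hC⟩ := h
  obtain ⟨o, ho⟩ := hC f rfl
  refine ⟨circuitCode C ++ outputCode n o, ⟨by simp [outputCode], ?_⟩, ?_, ?_⟩
  · exact List.forall_mem_append.2 ⟨isAllowed_circuitCode C, isAllowed_outputCode n o⟩
  · refine computes_iff.2 ⟨s', fun x => ?_⟩
    obtain ⟨ρ, hout, hnodes, -, hrun⟩ := run_circuitCode C le_rfl x
    rw [hrun, run_outputCode hout (hnodes o), ho]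
  · have hlen := length_circuitCode_le C
    rw [List.length_append, outputCode, List.length_cons, List.length_cons, List.length_singleton]
    omega

theorem PLIS_eq_PolySize : PLIS = PolySize := by
  refine Set.Subset.antisymm ?_ ?_
  · rintro f ⟨h, hh, H⟩
    have hpoly := PolyBound.of_mem_poly hh
    refine ⟨fun n => n + (h n + 1) * ((2 * h n + 1) * juntaSize 3),
      .add .id ((hpoly.add (.const 1)).mul ((((PolyBound.const 2).mul hpoly).add (.const 1)).mul
        (.const _))), fun n => ?_⟩
    obtain ⟨X, -, hX, hlen⟩ := H n
    exact hX.hasCircuit.mono (by dsimp only; gcongr) le_rfl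
  · rintro f ⟨h, hh, H⟩
    obtain ⟨h', hh', hle⟩ := (((PolyBound.const 4).mul hh).add (.const 3)).exists_mem_poly
    refine ⟨h', hh', fun n => ?_⟩
    obtain ⟨X, hX, hcomp, hlen⟩ := (H n).exists_computes
    exact ⟨X, hX, hcomp, hlen.trans (hle n)⟩

/-! ### Nondeterministic circuits reduce to 3SATC -/

theorem numDisj_strictMono : StrictMono numDisj := by
  intro a b h
  unfold numDisj
  have h1 : (2 * a).choose 1 < (2 * b).choose 1 := by simpa using h
  have h2 := Nat.choose_le_choose 2 (show 2 * a ≤ 2 * b by omega)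
  have h3 := Nat.choose_le_choose 3 (show 2 * a ≤ 2 * b by omega)
  omega

theorem numVars_numDisj (s : ℕ) : numVars (numDisj s) = s := by
  unfold numVars
  rw [Nat.findGreatest_eq_iff]
  exact ⟨numDisj_strictMono.le_apply, fun _ => le_rfl,
    fun m hm _ => not_le.2 (numDisj_strictMono hm)⟩

theorem numDisj_numVars_le (n : ℕ) : numDisj (numVars n) ≤ n :=
  Nat.findGreatest_spec (P := fun k => numDisj k ≤ n) (Nat.zero_le n) (by simp [numDisj])

theorem polyBound_numDisj : PolyBound numDisj := by
  refine ((((PolyBound.const 2).mul .id).pow 1).add (((PolyBound.const 2).mul .id).pow 2)).add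
    (((PolyBound.const 2).mul .id).pow 3) |>.mono fun k => ?_
  unfold numDisj
  gcongr <;> exact Nat.choose_le_pow _ _

/-- Truth of a disjunction, given as the set of its literals, under the assignment `σ`. -/
def ClauseHolds (σ : ℕ → Bool) (L : Finset Literal) : Prop := ∃ l ∈ L, Literal.Holds σ l

@[simp]
theorem clauseHolds_singleton (σ : ℕ → Bool) (l : Literal) :
    ClauseHolds σ {l} ↔ σ l.1 = l.2 := by
  simp only [ClauseHolds, Finset.mem_singleton, exists_eq_left, Literal.Holds]

@[simp]
theorem clauseHolds_insert (σ : ℕ → Bool) (l : Literal) (L : Finset Literal) :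
    ClauseHolds σ (insert l L) ↔ σ l.1 = l.2 ∨ ClauseHolds σ L := by
  simp only [ClauseHolds, Finset.mem_insert, exists_eq_or_imp, Literal.Holds]

/-- The Tseitin clauses expressing that variable `s` has the value of a gate. -/
def gateClauses {s : ℕ} : Gate s → List (Finset Literal)
  | .const b => [{(s, b)}]
  | .not i => [{(s, true), (↑i, true)}, {(s, false), (↑i, false)}]
  | .and i j => [{(s, false), (↑i, true)}, {(s, false), (↑j, true)},
      {(s, true), (↑i, false), (↑j, false)}]
  | .or i j => [{(s, true), (↑i, false)}, {(s, true), (↑j, false)},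
      {(s, false), (↑i, true), (↑j, true)}]

/-- The Tseitin clauses expressing that the variables have the values of the nodes of a circuit. -/
def circuitClauses {n : ℕ} : {s : ℕ} → Circuit n s → List (Finset Literal)
  | _, .inputs => []
  | _, .snoc C g => circuitClauses C ++ gateClauses g

theorem gateClauses_hold_iff {s : ℕ} (g : Gate s) (σ : ℕ → Bool) :
    (∀ L ∈ gateClauses g, ClauseHolds σ L) ↔ σ s = g.eval fun i => σ i := by
  cases g with
  | const b => simp [gateClauses, Gate.eval]
  | not i => cases hs : σ s <;> cases hi : σ i <;> simp [gateClauses, Gate.eval, hs, hi]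
  | and i j =>
    cases hs : σ s <;> cases hi : σ i <;> cases hj : σ j <;>
      simp [gateClauses, Gate.eval, hs, hi, hj]
  | or i j =>
    cases hs : σ s <;> cases hi : σ i <;> cases hj : σ j <;>
      simp [gateClauses, Gate.eval, hs, hi, hj]

theorem circuitClauses_hold_iff {n s : ℕ} (C : Circuit n s) (σ : ℕ → Bool) :
    (∀ L ∈ circuitClauses C, ClauseHolds σ L) ↔
      ∀ j : Fin s, σ j = C.eval (fun i : Fin n => σ i) j := by
  induction C with
  | inputs => simp [circuitClauses, Circuit.eval]
  | @snoc s C g ih =>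
    simp only [circuitClauses, List.mem_append, or_imp, forall_and, ih, gateClauses_hold_iff,
      Fin.forall_fin_succ', Circuit.eval, Fin.snoc_castSucc, Fin.snoc_last, Fin.val_castSucc,
      Fin.val_last]
    refine and_congr_right fun h => ?_
    rw [show (fun i : Fin s => σ i) = C.eval fun i : Fin n => σ i from funext h]

theorem disjSets_mono {a b : ℕ} (h : a ≤ b) : disjSets a ⊆ disjSets b :=
  fun _ hL => ⟨fun l hl => (hL.1 l hl).trans_le h, hL.2⟩

theorem singleton_mem_disjSets {a : Literal} {k : ℕ} (ha : a.1 < k) : {a} ∈ disjSets k :=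
  ⟨by simpa using ha, by simp, by simp⟩

theorem pair_mem_disjSets {a b : Literal} {k : ℕ} (ha : a.1 < k) (hb : b.1 < k) :
    {a, b} ∈ disjSets k :=
  ⟨Finset.forall_mem_insert .. |>.2 ⟨ha, by simpa using hb⟩, Finset.card_pos.2 ⟨a, by simp⟩,
    Finset.card_le_two.trans (by norm_num)⟩

theorem triple_mem_disjSets {a b c : Literal} {k : ℕ} (ha : a.1 < k) (hb : b.1 < k)
    (hc : c.1 < k) : {a, b, c} ∈ disjSets k :=
  ⟨Finset.forall_mem_insert .. |>.2 ⟨ha, Finset.forall_mem_insert .. |>.2 ⟨hb, by simpa using hc⟩⟩,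
    Finset.card_pos.2 ⟨a, by simp⟩, Finset.card_le_three⟩

theorem gateClauses_subset {s : ℕ} (g : Gate s) : ∀ L ∈ gateClauses g, L ∈ disjSets (s + 1) := by
  have hs := Nat.lt_succ_self s
  have hi : ∀ i : Fin s, (i : ℕ) < s + 1 := fun i => i.2.trans hs
  cases g <;> simp only [gateClauses, List.forall_mem_cons, List.not_mem_nil, IsEmpty.forall_iff,
    implies_true, and_true]
  case const b => exact singleton_mem_disjSets hs
  case not i => exact ⟨pair_mem_disjSets hs (hi i), pair_mem_disjSets hs (hi i)⟩
  all_goals exact ⟨pair_mem_disjSets hs (hi _), pair_mem_disjSets hs (hi _),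
    triple_mem_disjSets hs (hi _) (hi _)⟩

theorem circuitClauses_subset {n s : ℕ} (C : Circuit n s) :
    ∀ L ∈ circuitClauses C, L ∈ disjSets s := by
  induction C with
  | inputs => simp [circuitClauses]
  | snoc C g ih =>
    exact List.forall_mem_append.2
      ⟨fun L hL => disjSets_mono (Nat.le_succ _) (ih L hL), gateClauses_subset g⟩

theorem threeSATC_eq_true_iff_of_indicator (α : DisjNumbering) {k : ℕ} {P : Finset Literal → Prop}
    (hP : ∀ L, P L → L ∈ disjSets k) {b : Fin (numDisj k) → Bool}
    (hb : ∀ j, b j = true ↔ P (α.disj k j)) :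
    threeSATC α (numDisj k) b = true ↔ ∃ σ, ∀ L, P L → ClauseHolds σ L := by
  simp only [threeSATC, decide_eq_true_iff, numVars_numDisj]
  refine exists_congr fun σ => ⟨fun h L hL => ?_, fun h i _ hi => h _ ((hb i).1 hi)⟩
  obtain ⟨j, hj, rfl⟩ := (α.bijOn k).surjOn (hP L hL)
  exact h ⟨j, hj⟩ hj ((hb _).2 hL)

section Acceptance

variable {n h s : ℕ} {C : Circuit (n + h) s} {o : Fin s} {x : Fin n → Bool}

/-- The clauses of the formula expressing that the circuit `C` accepts, at node `o`, an input that
extends `x`: the variables `0, ..., s - 1` stand for the nodes of `C`. -/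
def acceptClauses (C : Circuit (n + h) s) (o : Fin s) (x : Fin n → Bool) : Set (Finset Literal) :=
  {L | L ∈ circuitClauses C ∨ L = {((o : ℕ), true)} ∨ ∃ i : Fin n, L = {((i : ℕ), x i)}}

theorem acceptClauses_subset : acceptClauses C o x ⊆ disjSets s := by
  rintro L (hL | rfl | ⟨i, rfl⟩)
  · exact circuitClauses_subset C L hL
  · exact singleton_mem_disjSets o.2
  · exact singleton_mem_disjSets ((i.castAdd h).2.trans_le C.le_size)

theorem acceptClauses_hold_iff {σ : ℕ → Bool} :
    (∀ L ∈ acceptClauses C o x, ClauseHolds σ L) ↔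
      (∀ j : Fin s, σ j = C.eval (fun i => σ i) j) ∧ σ o = true ∧ ∀ i : Fin n, σ i = x i := by
  simp only [acceptClauses, Set.mem_ofPred_eq, or_imp, forall_and, forall_eq, forall_exists_index,
    forall_comm (α := Finset Literal), circuitClauses_hold_iff, clauseHolds_singleton]

theorem exists_acceptClauses_hold_iff :
    (∃ σ, ∀ L ∈ acceptClauses C o x, ClauseHolds σ L) ↔
      ∃ u, C.eval (Fin.append x u) o = true := by
  simp only [acceptClauses_hold_iff]
  constructor
  · rintro ⟨σ, hnodes, ho, hx⟩
    refine ⟨fun j => σ (n + j), ?_⟩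
    rw [← ho, hnodes]
    congr 1
    refine funext (Fin.addCases (fun i => ?_) fun i => ?_)
    · rw [Fin.append_left, Fin.val_castAdd, hx]
    · rw [Fin.append_right, Fin.val_natAdd]
  · rintro ⟨u, hu⟩
    let σ : ℕ → Bool := fun j => if hj : j < s then C.eval (Fin.append x u) ⟨j, hj⟩ else false
    have hnode : ∀ j : Fin s, σ j = C.eval (Fin.append x u) j := fun j => dif_pos j.2
    have hinput : ∀ i : Fin (n + h), σ i = Fin.append x u i := fun i =>
      (hnode (i.castLE C.le_size)).trans (C.eval_castLE _ i)
    refine ⟨σ, fun j => ?_, (hnode o).trans hu, fun i => ?_⟩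
    · rw [hnode, funext hinput]
    · exact (hinput (i.castAdd h)).trans (Fin.append_left x u i)

open Classical in
theorem isProjection_acceptClauses (C : Circuit (n + h) s) (o : Fin s) {N : ℕ}
    (clause : Fin N → Finset Literal) :
    IsProjection fun x j => decide (clause j ∈ acceptClauses C o x) := by
  intro j
  by_cases hj : ∃ (i : Fin n) (b : Bool), clause j = {((i : ℕ), b)}
  · obtain ⟨i, b, hib⟩ := hj
    refine .of_apply i fun x y (hxy : x i = y i) => ?_
    simp only [acceptClauses, Set.mem_ofPred_eq, hib, decide_eq_decide, Finset.singleton_inj,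
      Prod.mk.injEq]
    refine or_congr_right (or_congr_right (exists_congr fun k => and_congr_right fun hk => ?_))
    rw [← Fin.ext hk, hxy]
  · have hunit : ∀ x : Fin n → Bool, ¬∃ i : Fin n, clause j = {((i : ℕ), x i)} :=
      fun x ⟨i, hi⟩ => hj ⟨i, _, hi⟩
    exact .of_forall_eq fun x y => by simp only [acceptClauses, Set.mem_ofPred_eq, hunit]

end Acceptance

/-- Boolean function families computed by polynomial-size nondeterministic circuits, which may guess
the values of additional input nodes. -/
def NondetPolySize : Set BoolFunFamily :=
  {f | ∃ p : ℕ → ℕ, PolyBound p ∧ ∀ n, ∃ (h : ℕ) (g : (Fin (n + h) → Bool) → Bool),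
    HasCircuit (n + h) (p n) {g} ∧ ∀ x, f n x = true ↔ ∃ u, g (Fin.append x u) = true}

theorem NondetPolySize_subset_PolySize {α : DisjNumbering} (hα : threeSATC α ∈ PolySize) :
    NondetPolySize ⊆ PolySize := by
  classical
  rintro f ⟨p, hp, hf⟩
  refine mem_PolySize_of_projection hα (polyBound_numDisj.comp hp) fun n => ?_
  obtain ⟨h, g, ⟨s, hs, C, hC⟩, hg⟩ := hf n
  obtain ⟨o, ho⟩ := hC g rfl
  refine ⟨numDisj s, numDisj_strictMono.monotone hs, _,
    isProjection_acceptClauses C o fun j => α.disj s j, fun x => ?_⟩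
  rw [Bool.eq_iff_iff, hg, threeSATC_eq_true_iff_of_indicator α (P := (· ∈ acceptClauses C o x))
    acceptClauses_subset fun _ => decide_eq_true_iff, exists_acceptClauses_hold_iff]
  simp only [ho]

/-! ### Simulation of stack machines by circuits -/

section TM2

variable {K : Type} {Γ : K → Type} {Λ σ : Type}

/-- The total number of stack operations in a statement, which bounds how deep into the stacks its
execution reaches. -/
def stmtDepth : TM2.Stmt Γ Λ σ → ℕ
  | .push _ _ q => stmtDepth q + 1
  | .peek _ _ q => stmtDepth q + 1
  | .pop _ _ q => stmtDepth q + 1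
  | .load _ q => stmtDepth q
  | .branch _ q₁ q₂ => stmtDepth q₁ + stmtDepth q₂
  | .goto _ => 0
  | .halt => 0

open Classical in
/-- The symbols that can be pushed by a statement. -/
noncomputable def stmtSymbols [Fintype σ] : TM2.Stmt Γ Λ σ → Finset (Σ k, Γ k)
  | .push k f q => Finset.univ.image (fun v => (⟨k, f v⟩ : Σ k, Γ k)) ∪ stmtSymbols q
  | .peek _ _ q => stmtSymbols q
  | .pop _ _ q => stmtSymbols q
  | .load _ q => stmtSymbols q
  | .branch _ q₁ q₂ => stmtSymbols q₁ ∪ stmtSymbols q₂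
  | .goto _ => ∅
  | .halt => ∅

/-- The stacks agree at depths below `D` and at distance at most `D` from depth `i`. If `D` is the
number of stack operations, this determines the new symbol at depth `i`. -/
def AgreeNear (D i : ℕ) (S S' : ∀ k, List (Γ k)) : Prop :=
  ∀ k j, (j < D ∨ (i ≤ j + D ∧ j ≤ i + D)) → (S k)[j]? = (S' k)[j]?

theorem AgreeNear.mono {D E i : ℕ} {S S' : ∀ k, List (Γ k)} (h : AgreeNear E i S S')
    (hDE : D ≤ E) : AgreeNear D i S S' :=
  fun k j hj => h k j (by omega)

theorem AgreeNear.head? {D i : ℕ} {S S' : ∀ k, List (Γ k)} (h : AgreeNear (D + 1) i S S') (k : K) :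
    (S k).head? = (S' k).head? := by
  simpa [List.head?_eq_getElem?] using h k 0 (by omega)

/-- All stack symbols are in the alphabet `A`, which must be finite although the stack alphabets of
a machine need not be. -/
def SymbolsIn (A : Finset (Σ k, Γ k)) (S : ∀ k, List (Γ k)) : Prop :=
  ∀ k, ∀ a ∈ S k, (⟨k, a⟩ : Σ k, Γ k) ∈ A

open Classical in
/-- The bits describing a configuration: label, internal state, and the symbols from `A` at depths
below `H`. -/
noncomputable def cfgBit (A : Finset (Σ k, Γ k)) (H : ℕ) :
    Option Λ ⊕ σ ⊕ A × Fin H → TM2.Cfg Γ Λ σ → Bool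
  | .inl l, c => decide (c.l = l)
  | .inr (.inl v), c => decide (c.var = v)
  | .inr (.inr (a, i)), c => decide ((c.stk a.1.1)[(i : ℕ)]? = some a.1.2)

theorem getElem?_stk_eq_of_cfgBit {A : Finset (Σ k, Γ k)} {H : ℕ} {c c' : TM2.Cfg Γ Λ σ}
    (hc : SymbolsIn A c.stk) (hc' : SymbolsIn A c'.stk) (k : K) (i : Fin H)
    (h : ∀ a, cfgBit A H (.inr (.inr (a, i))) c = cfgBit A H (.inr (.inr (a, i))) c') :
    (c.stk k)[(i : ℕ)]? = (c'.stk k)[(i : ℕ)]? := by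
  have hiff : ∀ a, (⟨k, a⟩ : Σ k, Γ k) ∈ A →
      ((c.stk k)[(i : ℕ)]? = some a ↔ (c'.stk k)[(i : ℕ)]? = some a) :=
    fun a ha => decide_eq_decide.1 (h ⟨_, ha⟩)
  ext a
  exact ⟨fun ha => (hiff a (hc k a (List.mem_of_getElem? ha))).1 ha,
    fun ha => (hiff a (hc' k a (List.mem_of_getElem? ha))).2 ha⟩

variable [DecidableEq K]

theorem AgreeNear.push {D i : ℕ} {S S' : ∀ k, List (Γ k)} (h : AgreeNear (D + 1) i S S') (k : K)
    (a : Γ k) :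
    AgreeNear D i (Function.update S k (a :: S k)) (Function.update S' k (a :: S' k)) := by
  intro k' j hj
  by_cases hk : k' = k
  · subst hk
    cases j with
    | zero => simp
    | succ j => simpa using h k' j (by omega)
  · simpa [Function.update_of_ne hk] using h k' j (by omega)

theorem AgreeNear.pop {D i : ℕ} {S S' : ∀ k, List (Γ k)} (h : AgreeNear (D + 1) i S S') (k : K) :
    AgreeNear D i (Function.update S k (S k).tail) (Function.update S' k (S' k).tail) := by
  intro k' j hj
  by_cases hk : k' = k
  · subst hk
    simpa using h k' (j + 1) (by omega)
  · simpa [Function.update_of_ne hk] using h k' j (by omega)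

theorem stepAux_congr {i : ℕ} (q : TM2.Stmt Γ Λ σ) (v : σ) (S S' : ∀ k, List (Γ k)) {D : ℕ}
    (hq : stmtDepth q ≤ D) (h : AgreeNear D i S S') :
    (TM2.stepAux q v S).l = (TM2.stepAux q v S').l ∧
    (TM2.stepAux q v S).var = (TM2.stepAux q v S').var ∧
    ∀ k, ((TM2.stepAux q v S).stk k)[i]? = ((TM2.stepAux q v S').stk k)[i]? := by
  induction q generalizing v S S' D with
  | push k f q ih =>
    obtain ⟨D, rfl⟩ : ∃ E, D = E + 1 := ⟨D - 1, by simp only [stmtDepth] at hq; omega⟩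
    exact ih _ _ _ (by simpa [stmtDepth] using hq) (h.push k _)
  | peek k f q ih =>
    obtain ⟨D, rfl⟩ : ∃ E, D = E + 1 := ⟨D - 1, by simp only [stmtDepth] at hq; omega⟩
    simp only [TM2.stepAux, h.head? k]
    exact ih _ _ _ (by simpa [stmtDepth] using hq) (h.mono (Nat.le_succ D))
  | pop k f q ih =>
    obtain ⟨D, rfl⟩ : ∃ E, D = E + 1 := ⟨D - 1, by simp only [stmtDepth] at hq; omega⟩
    simp only [TM2.stepAux, h.head? k]
    exact ih _ _ _ (by simpa [stmtDepth] using hq) (h.pop k)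
  | load a q ih => exact ih _ _ _ hq h
  | branch f q₁ q₂ ih₁ ih₂ =>
    simp only [stmtDepth] at hq
    simp only [TM2.stepAux]
    cases f v
    · exact ih₂ _ _ _ (by omega) h
    · exact ih₁ _ _ _ (by omega) h
  | goto l => exact ⟨rfl, rfl, fun k => h k i (by omega)⟩
  | halt => exact ⟨rfl, rfl, fun k => h k i (by omega)⟩

theorem length_stepAux_le (q : TM2.Stmt Γ Λ σ) (v : σ) (S : ∀ k, List (Γ k)) (k : K) :
    ((TM2.stepAux q v S).stk k).length ≤ (S k).length + stmtDepth q := by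
  induction q generalizing v S with
  | push k' f q ih =>
    refine (ih _ _).trans ?_
    rw [stmtDepth]
    rcases eq_or_ne k k' with rfl | hk
    · rw [Function.update_self, List.length_cons]
      omega
    · rw [Function.update_of_ne hk]
      omega
  | peek k' f q ih => exact (ih _ _).trans (Nat.le_succ _)
  | pop k' f q ih =>
    refine (ih _ _).trans ?_
    rw [stmtDepth]
    rcases eq_or_ne k k' with rfl | hk
    · rw [Function.update_self, List.length_tail]
      omega
    · rw [Function.update_of_ne hk]
      omega
  | load a _ ih => exact ih _ _
  | branch f q₁ q₂ ih₁ ih₂ =>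
    simp only [TM2.stepAux, stmtDepth]
    cases f v
    · exact (ih₂ _ _).trans (by omega)
    · exact (ih₁ _ _).trans (by omega)
  | goto l => exact le_rfl
  | halt => exact le_rfl

theorem SymbolsIn.stepAux [Fintype σ] {A : Finset (Σ k, Γ k)} (q : TM2.Stmt Γ Λ σ)
    (hq : stmtSymbols q ⊆ A) (v : σ) {S : ∀ k, List (Γ k)} (h : SymbolsIn A S) :
    SymbolsIn A (TM2.stepAux q v S).stk := by
  classical
  induction q generalizing v S with
  | push k' f q ih =>
    simp only [stmtSymbols, Finset.union_subset_iff] at hq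
    refine ih hq.2 _ fun k a ha => ?_
    by_cases hk : k = k'
    · subst hk
      simp only [Function.update_self, List.mem_cons] at ha
      rcases ha with rfl | ha
      · exact hq.1 (by simp)
      · exact h k a ha
    · rw [Function.update_of_ne hk] at ha
      exact h k a ha
  | peek k' f q ih => exact ih hq _ h
  | pop k' f q ih =>
    refine ih hq _ fun k a ha => ?_
    by_cases hk : k = k'
    · subst hk
      rw [Function.update_self] at ha
      exact h k a (List.mem_of_mem_tail ha)
    · rw [Function.update_of_ne hk] at ha
      exact h k a ha
  | load a q ih => exact ih hq _ h
  | branch f q₁ q₂ ih₁ ih₂ =>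
    simp only [stmtSymbols, Finset.union_subset_iff] at hq
    simp only [TM2.stepAux]
    cases f v
    · exact ih₂ hq.2 _ h
    · exact ih₁ hq.1 _ h
  | goto l => exact h
  | halt => exact h

/-- One step of a machine; halting configurations do not change. -/
def nextCfg (M : Λ → TM2.Stmt Γ Λ σ) (c : TM2.Cfg Γ Λ σ) : TM2.Cfg Γ Λ σ :=
  c.l.elim c fun l => TM2.stepAux (M l) c.var c.stk

theorem nextCfg_iterate_of_step_iterate {M : Λ → TM2.Stmt Γ Λ σ} {c c' : TM2.Cfg Γ Λ σ} {t : ℕ}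
    (h : (flip bind (TM2.step M))^[t] (some c) = some c') : (nextCfg M)^[t] c = c' := by
  induction t generalizing c with
  | zero => exact Option.some.inj h
  | succ t ih =>
    rw [Function.iterate_succ_apply] at h ⊢
    obtain ⟨_ | l, v, S⟩ := c
    · have hnone : flip bind (TM2.step M) (some ⟨none, v, S⟩) = none := rfl
      rw [hnone, Function.iterate_fixed rfl] at h
      cases h
    · exact ih h

theorem nextCfg_iterate_of_halted {M : Λ → TM2.Stmt Γ Λ σ} {c c' : TM2.Cfg Γ Λ σ} {t T : ℕ}
    (htT : t ≤ T) (h : (nextCfg M)^[t] c = c') (hc' : c'.l = none) : (nextCfg M)^[T] c = c' := by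
  obtain ⟨r, rfl⟩ := Nat.exists_eq_add_of_le' htT
  rw [Function.iterate_add_apply, h]
  exact Function.iterate_fixed (by rw [nextCfg, hc', Option.elim]) r

section Machine

variable {M : Λ → TM2.Stmt Γ Λ σ} {A : Finset (Σ k, Γ k)} {D H : ℕ}

theorem nextCfg_congr (hD : ∀ l, stmtDepth (M l) ≤ D) {i : ℕ} {c c' : TM2.Cfg Γ Λ σ}
    (hl : c.l = c'.l) (hvar : c.var = c'.var) (hstk : AgreeNear D i c.stk c'.stk) :
    (nextCfg M c).l = (nextCfg M c').l ∧ (nextCfg M c).var = (nextCfg M c').var ∧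
      ∀ k, ((nextCfg M c).stk k)[i]? = ((nextCfg M c').stk k)[i]? := by
  obtain ⟨l, v, S⟩ := c
  obtain ⟨l', v', S'⟩ := c'
  obtain ⟨rfl, rfl⟩ : l = l' ∧ v = v' := ⟨hl, hvar⟩
  cases l with
  | none => exact ⟨rfl, rfl, fun k => hstk k i (by omega)⟩
  | some l => exact stepAux_congr (M l) v S S' (hD l) hstk

theorem SymbolsIn.nextCfg_iterate [Fintype σ] (hA : ∀ l, stmtSymbols (M l) ⊆ A)
    {c : TM2.Cfg Γ Λ σ} (hc : SymbolsIn A c.stk) (t : ℕ) :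
    SymbolsIn A ((nextCfg M)^[t] c).stk := by
  induction t with
  | zero => exact hc
  | succ t ih =>
    rw [Function.iterate_succ_apply', nextCfg]
    cases ((nextCfg M)^[t] c).l with
    | none => exact ih
    | some l => exact ih.stepAux _ (hA l) _

theorem length_nextCfg_iterate_le (hD : ∀ l, stmtDepth (M l) ≤ D) (c : TM2.Cfg Γ Λ σ) (t : ℕ)
    (k : K) : (((nextCfg M)^[t] c).stk k).length ≤ (c.stk k).length + t * D := by
  induction t with
  | zero => exact Nat.le_add_right _ _
  | succ t ih =>
    rw [Function.iterate_succ_apply', nextCfg, Nat.succ_mul]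
    cases ((nextCfg M)^[t] c).l with
    | none => exact ih.trans (by omega)
    | some l => exact (length_stepAux_le _ _ _ k).trans (by have := hD l; omega)

/-- The depths below `H` at which `AgreeNear D i` requires agreement. -/
def depthWindow (H D i : ℕ) : Finset (Fin H) :=
  {j | (j : ℕ) < D ∨ (i ≤ j + D ∧ (j : ℕ) ≤ i + D)}

theorem card_depthWindow_le (H D i : ℕ) : (depthWindow H D i).card ≤ 3 * D + 1 := by
  have hsub : (depthWindow H D i).map Fin.valEmbedding ⊆
      Finset.range D ∪ Finset.Icc (i - D) (i + D) := by
    refine Finset.map_subset_iff_subset_preimage.2 fun j hj => ?_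
    simp only [depthWindow, Finset.mem_filter_univ] at hj
    simp only [Finset.mem_preimage, Fin.valEmbedding_apply, Finset.mem_union, Finset.mem_range,
      Finset.mem_Icc]
    omega
  have hcard := (Finset.card_le_card hsub).trans (Finset.card_union_le _ _)
  rw [Finset.card_map, Finset.card_range, Nat.card_Icc] at hcard
  omega

variable [Fintype Λ] [Fintype σ]

theorem isJunta_cfgBit_nextCfg (hD : ∀ l, stmtDepth (M l) ≤ D) {X : Type*}
    {c : X → TM2.Cfg Γ Λ σ} (hsym : ∀ x, SymbolsIn A (c x).stk)
    (hlen : ∀ x k, ((c x).stk k).length ≤ H) (p : Option Λ ⊕ σ ⊕ A × Fin H) :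
    IsJunta (Fintype.card Λ + 1 + (Fintype.card σ + A.card * (3 * D + 1)))
      (fun p x => cfgBit A H p (c x)) fun x => cfgBit A H p (nextCfg M (c x)) := by
  classical
  let i : ℕ := p.elim (fun _ => 0) (Sum.elim (fun _ => 0) fun q => q.2)
  refine ⟨Finset.univ.disjSum (Finset.univ.disjSum (Finset.univ ×ˢ depthWindow H D i)),
    ?_, fun x y hxy => ?_⟩
  · simp only [Finset.card_disjSum, Finset.card_univ, Finset.card_product, Fintype.card_option,
      Fintype.card_coe]
    gcongr
    exact card_depthWindow_le H D i
  · have hl : (c x).l = (c y).l := by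
      simpa only [cfgBit, decide_true, decide_eq_true_eq] using hxy (.inl (c y).l) (by simp)
    have hvar : (c x).var = (c y).var := by
      simpa only [cfgBit, decide_true, decide_eq_true_eq] using
        hxy (.inr (.inl (c y).var)) (by simp)
    have hstk : AgreeNear D i (c x).stk (c y).stk := fun k j hj => by
      by_cases hjH : j < H
      · exact getElem?_stk_eq_of_cfgBit (hsym x) (hsym y) k ⟨j, hjH⟩ fun a =>
          hxy (.inr (.inr (a, ⟨j, hjH⟩))) (by simpa [depthWindow] using hj)
      · rw [List.getElem?_eq_none ((hlen x k).trans (not_lt.1 hjH)),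
          List.getElem?_eq_none ((hlen y k).trans (not_lt.1 hjH))]
    obtain ⟨hl', hvar', hstk'⟩ := nextCfg_congr hD hl hvar hstk
    rcases p with l | v | ⟨a, j⟩
    · simp only [cfgBit, hl']
    · simp only [cfgBit, hvar']
    · exact congrArg (fun o => decide (o = some a.1.2)) (hstk' a.1.1)

/-- The size of the circuits in the simulation of `T` steps of a machine on inputs with `n` bits. -/
def simulationSize (Λ σ : Type) [Fintype Λ] [Fintype σ] (α D n T H : ℕ) : ℕ :=
  n + (T + 1) * ((Fintype.card Λ + 1 + (Fintype.card σ + α * H)) *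
    juntaSize (Fintype.card Λ + 1 + (Fintype.card σ + α * (3 * D + 1))))

theorem hasCircuit_cfgBit_nextCfg_iterate (hA : ∀ l, stmtSymbols (M l) ⊆ A)
    (hD : ∀ l, stmtDepth (M l) ≤ D) {n : ℕ} {init : (Fin n → Bool) → TM2.Cfg Γ Λ σ} {T : ℕ}
    (hlen : ∀ x k, ((init x).stk k).length + T * D ≤ H)
    (hsym : ∀ x, SymbolsIn A (init x).stk)
    (hinit : ∀ p, IsJunta 1 (fun j x => x j) fun x => cfgBit A H p (init x)) :
    HasCircuit n (simulationSize Λ σ A.card D n T H)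
      (Set.range fun p x => cfgBit A H p ((nextCfg M)^[T] (init x))) := by
  refine (HasCircuit.tableau
    (m := Fintype.card Λ + 1 + (Fintype.card σ + A.card * (3 * D + 1)))
    (fun t p x => cfgBit A H p ((nextCfg M)^[t] (init x))) T
    (fun p => (hinit p).mono (by omega)) fun t ht p => ?_).mono (le_of_eq ?_) le_rfl
  · simp only [Function.iterate_succ_apply']
    refine isJunta_cfgBit_nextCfg hD (fun x => (hsym x).nextCfg_iterate hA t) (fun x k => ?_) p
    refine (length_nextCfg_iterate_le hD _ t k).trans ((hlen x k).trans' ?_)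
    gcongr
  · simp only [simulationSize, Fintype.card_sum, Fintype.card_option, Fintype.card_prod,
      Fintype.card_coe, Fintype.card_fin]

end Machine

end TM2

section FinTM2

variable (tm : FinTM2)

attribute [local instance] FinTM2.ΛFin FinTM2.σFin FinTM2.Γk₀Fin

open Classical in
/-- An alphabet for all stacks of a machine: the input symbols, the symbols that the program can
push, and a given output symbol. -/
noncomputable def machineSymbols (a : tm.Γ tm.k₁) : Finset (Σ k, tm.Γ k) :=
  insert ⟨tm.k₁, a⟩ (Finset.univ.image (Sigma.mk tm.k₀) ∪
    Finset.univ.biUnion fun l => stmtSymbols (tm.m l))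

/-- The size of the circuits that simulate `T` steps of a machine on inputs with `n` bits. -/
noncomputable def machineSize (a : tm.Γ tm.k₁) (n T : ℕ) : ℕ :=
  simulationSize tm.Λ tm.σ (machineSymbols tm a).card (∑ l, stmtDepth (tm.m l)) n T
    (n + T * ∑ l, stmtDepth (tm.m l) + 1)

/-- The configuration `initList tm w`, whose type is there hidden behind `FinTM2.Cfg`. -/
def inputCfg (w : List (tm.Γ tm.k₀)) : TM2.Cfg tm.Γ tm.Λ tm.σ := initList tm w

variable {tm}

theorem inputCfg_stk (w : List (tm.Γ tm.k₀)) : (inputCfg tm w).stk tm.k₀ = w := by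
  simp [inputCfg, initList]

theorem inputCfg_stk_of_ne {k : tm.K} (hk : k ≠ tm.k₀) (w : List (tm.Γ tm.k₀)) :
    (inputCfg tm w).stk k = [] := by
  simp [inputCfg, initList, hk]

theorem length_inputCfg_stk_le (w : List (tm.Γ tm.k₀)) (k : tm.K) :
    ((inputCfg tm w).stk k).length ≤ w.length := by
  rcases eq_or_ne k tm.k₀ with rfl | hk
  · rw [inputCfg_stk]
  · exact (inputCfg_stk_of_ne hk w).symm ▸ Nat.zero_le _

theorem symbolsIn_inputCfg (a : tm.Γ tm.k₁) (w : List (tm.Γ tm.k₀)) :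
    SymbolsIn (machineSymbols tm a) (inputCfg tm w).stk := by
  intro k b hb
  rcases eq_or_ne k tm.k₀ with rfl | hk
  · simp [machineSymbols]
  · exact absurd (inputCfg_stk_of_ne hk w ▸ hb) List.not_mem_nil

theorem isJunta_cfgBit_inputCfg {n : ℕ} (sym : Fin n → Bool → tm.Γ tm.k₀)
    (A : Finset (Σ k, tm.Γ k)) {H : ℕ} (p : Option tm.Λ ⊕ tm.σ ⊕ A × Fin H) :
    IsJunta 1 (fun j (x : Fin n → Bool) => x j)
      fun x => cfgBit A H p (inputCfg tm (List.ofFn fun i => sym i (x i))) := by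
  rcases p with _ | _ | ⟨⟨⟨k, b⟩, hb⟩, i⟩
  iterate 2 exact .of_forall_eq fun _ _ => rfl
  have hbit : ∀ x y : Fin n → Bool,
      ((inputCfg tm (List.ofFn fun i => sym i (x i))).stk k)[(i : ℕ)]? =
        ((inputCfg tm (List.ofFn fun i => sym i (y i))).stk k)[(i : ℕ)]? →
      cfgBit A H (.inr (.inr (⟨⟨k, b⟩, hb⟩, i))) (inputCfg tm (List.ofFn fun i => sym i (x i))) =
        cfgBit A H (.inr (.inr (⟨⟨k, b⟩, hb⟩, i))) (inputCfg tm (List.ofFn fun i => sym i (y i))) :=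
    fun x y hxy => by rw [cfgBit, cfgBit, decide_eq_decide, hxy]
  rcases eq_or_ne k tm.k₀ with rfl | hk
  · by_cases hi : (i : ℕ) < n
    · exact .of_apply ⟨i, hi⟩ fun x y hxy => hbit x y <| by
        simp only [inputCfg_stk, List.getElem?_ofFn, dif_pos hi, hxy]
    · exact .of_forall_eq fun x y => hbit x y <| by
        simp only [inputCfg_stk, List.getElem?_ofFn, dif_neg hi]
  · exact .of_forall_eq fun x y => hbit x y <| by simp only [inputCfg_stk_of_ne hk]

theorem hasCircuit_of_outputsInTime {n T : ℕ} {sym : Fin n → Bool → tm.Γ tm.k₀}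
    {out : (Fin n → Bool) → List (tm.Γ tm.k₁)}
    (hout : ∀ x, Nonempty (TM2OutputsInTime tm (List.ofFn fun i => sym i (x i)) (some (out x)) T))
    {a : tm.Γ tm.k₁} {F : (Fin n → Bool) → Bool} (hF : ∀ x, F x = true ↔ (out x)[0]? = some a) :
    HasCircuit n (machineSize tm a n T) {F} := by
  classical
  have hA : ∀ l, stmtSymbols (tm.m l) ⊆ machineSymbols tm a := fun l =>
    (Finset.subset_biUnion_of_mem (fun l => stmtSymbols (tm.m l)) (Finset.mem_univ l)).trans
      (Finset.subset_union_right.trans (Finset.subset_insert _ _))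
  have hD : ∀ l, stmtDepth (tm.m l) ≤ ∑ l, stmtDepth (tm.m l) := fun l =>
    Finset.single_le_sum (f := fun l => stmtDepth (tm.m l)) (fun _ _ => Nat.zero_le _)
      (Finset.mem_univ l)
  refine (hasCircuit_cfgBit_nextCfg_iterate hA hD (fun x k => ?_)
    (fun x => symbolsIn_inputCfg a _) (isJunta_cfgBit_inputCfg sym _)).mono le_rfl ?_
  · have hlen := length_inputCfg_stk_le (List.ofFn fun i => sym i (x i)) k
    rw [List.length_ofFn] at hlen
    omega
  · rintro _ rfl
    refine ⟨.inr (.inr (⟨⟨tm.k₁, a⟩, Finset.mem_insert_self _ _⟩, ⟨0, Nat.succ_pos _⟩)),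
      funext fun x => ?_⟩
    obtain ⟨hrun⟩ := hout x
    have hrun' := nextCfg_iterate_of_halted hrun.steps_le_m
      (nextCfg_iterate_of_step_iterate hrun.evals_in_steps) rfl
    have hhalt : ((nextCfg tm.m)^[T] (inputCfg tm (List.ofFn fun i => sym i (x i)))).stk tm.k₁ =
        out x := (congrArg (fun c => TM2.Cfg.stk c tm.k₁) hrun').trans (by simp [haltList])
    rw [Bool.eq_iff_iff, hF]
    simp only [cfgBit, hhalt, decide_eq_true_iff]

theorem polyBound_machineSize (a : tm.Γ tm.k₁) {N T : ℕ → ℕ} (hN : PolyBound N)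
    (hT : PolyBound T) : PolyBound fun n => machineSize tm a (N n) (T n) :=
  hN.add ((hT.add (.const 1)).mul (((PolyBound.const _).add ((PolyBound.const _).add
    ((PolyBound.const _).mul ((hN.add (hT.mul (.const _))).add (.const 1))))).mul (.const _)))

end FinTM2

theorem encode_ofFn_append {n h : ℕ} (x : Fin n → Bool) (u : Fin h → Bool) :
    (Computability.encodingProd (Computability.encodingList Bool)
      (Computability.encodingList Bool)).encode (List.ofFn x, List.ofFn u) =
      List.ofFn fun i : Fin (n + h) =>
        if (i : ℕ) < n then .inl (Fin.append x u i) else .inr (Fin.append x u i) := by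
  have hsplit : (fun i : Fin (n + h) => if (i : ℕ) < n then (.inl (Fin.append x u i) : Bool ⊕ Bool)
      else .inr (Fin.append x u i)) = Fin.append (fun i => .inl (x i)) fun i => .inr (u i) := by
    refine funext (Fin.addCases (fun i => ?_) fun i => ?_) <;> simp
  rw [hsplit, List.ofFn_fin_append]
  simp [Computability.encodingProd, Computability.encodingList, List.map_ofFn, Function.comp_def]

theorem charFamily_mem_NondetPolySize {L : Language Bool} (hL : L ∈ NP) :
    charFamily L ∈ NondetPolySize := by
  obtain ⟨h, hh, V, ⟨⟨⟨tm, ein, eout⟩, time, outputs⟩⟩, hV⟩ := hL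
  have hN : PolyBound fun n => n + h n := PolyBound.id.add (.of_mem_poly hh)
  refine ⟨_, polyBound_machineSize (tm := tm) (eout.symm true) hN ((PolyBound.eval time).comp hN),
    fun n => ⟨h n, fun z => V (List.ofFn fun i => z (i.castAdd _))
      (List.ofFn fun i => z (i.natAdd n)), ?_, fun x => ?_⟩⟩
  · refine hasCircuit_of_outputsInTime
      (sym := fun i b => ein.symm (if i < n then .inl b else .inr b))
      (out := fun z => [eout.symm (V (List.ofFn fun i => z (i.castAdd _))
        (List.ofFn fun i => z (i.natAdd n)))]) (fun z => ⟨?_⟩) fun z => by simp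
    have hout := outputs (List.ofFn fun i => z (i.castAdd _), List.ofFn fun i => z (i.natAdd n))
    rw [encode_ofFn_append, Fin.append_castAdd_natAdd, List.map_ofFn, List.length_ofFn] at hout
    exact hout
  · rw [charFamily_eq_true_iff, hV, List.length_ofFn]
    simp only [Fin.append_left, Fin.append_right]
    constructor
    · rintro ⟨u, hu, hacc⟩
      obtain ⟨u, rfl⟩ : ∃ v : Fin (h n) → Bool, List.ofFn v = u := by
        rw [← hu]
        exact ⟨u.get, List.ofFn_get u⟩
      exact ⟨u, hacc⟩
    · exact fun ⟨u, hu⟩ => ⟨List.ofFn u, List.length_ofFn, hu⟩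

/-! ### Codes of formulas -/

/-- The number with the given binary digits, least significant first. -/
def ofDigits (d : List Bool) : ℕ := d.foldr Nat.bit 0

theorem ofDigits_bits (n : ℕ) : ofDigits n.bits = n := by
  induction n using Nat.binaryRec' with
  | zero => simp [ofDigits]
  | bit b n h ih =>
    rw [Nat.bits_append_bit n b h]
    simpa [ofDigits] using congrArg (Nat.bit b) ih

/-- Self-delimiting code of a list of binary digits. -/
def encodeDigits (d : List Bool) : List Bool := d.flatMap (fun b => [true, b]) ++ [false]

theorem encodeLiteral_eq (l : Literal) : encodeLiteral l = l.2 :: encodeDigits l.1.bits := rfl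

@[simp]
theorem encodeDigits_nil : encodeDigits [] = [false] := rfl

@[simp]
theorem encodeDigits_cons (b : Bool) (d : List Bool) :
    encodeDigits (b :: d) = true :: b :: encodeDigits d := rfl

theorem length_encodeDigits (d : List Bool) : (encodeDigits d).length = 2 * d.length + 1 := by
  simp [encodeDigits, List.length_flatMap, mul_comm]

theorem encodeDigits_append_inj {d d' r r' : List Bool}
    (h : encodeDigits d ++ r = encodeDigits d' ++ r') : d = d' ∧ r = r' := by
  induction d generalizing d' with
  | nil => cases d' <;> simp_all
  | cons b d ih =>
    cases d' with
    | nil => simp at h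
    | cons b' d' =>
      simp only [encodeDigits_cons, List.cons_append, List.cons.injEq, true_and] at h
      obtain ⟨rfl, h⟩ := h
      obtain ⟨rfl, rfl⟩ := ih h
      exact ⟨rfl, rfl⟩

theorem encodeLiteral_append_inj {l l' : Literal} {r r' : List Bool}
    (h : encodeLiteral l ++ r = encodeLiteral l' ++ r') : l = l' ∧ r = r' := by
  obtain ⟨v, s⟩ := l
  obtain ⟨v', s'⟩ := l'
  simp only [encodeLiteral_eq, List.cons_append, List.cons.injEq] at h
  obtain ⟨rfl, h⟩ := h
  obtain ⟨hb, rfl⟩ := encodeDigits_append_inj h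
  rw [← ofDigits_bits v, hb, ofDigits_bits]
  exact ⟨rfl, rfl⟩

@[simp]
theorem encodeClause_nil : encodeClause [] = [false] := rfl

@[simp]
theorem encodeClause_cons (l : Literal) (c : List Literal) :
    encodeClause (l :: c) = true :: (encodeLiteral l ++ encodeClause c) := by
  simp [encodeClause]

theorem encodeClause_append_inj {c c' : List Literal} {r r' : List Bool}
    (h : encodeClause c ++ r = encodeClause c' ++ r') : c = c' ∧ r = r' := by
  induction c generalizing c' with
  | nil => cases c' <;> simp_all
  | cons l c ih =>
    cases c' with
    | nil => simp at h
    | cons l' c' =>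
      simp only [encodeClause_cons, List.cons_append, List.append_assoc, List.cons.injEq,
        true_and] at h
      obtain ⟨rfl, h'⟩ := encodeLiteral_append_inj h
      obtain ⟨rfl, rfl⟩ := ih h'
      exact ⟨rfl, rfl⟩

theorem encodeClause_ne_nil (c : List Literal) : encodeClause c ≠ [] := by
  cases c <;> simp

@[simp]
theorem encodeCNF_nil : encodeCNF [] = [] := rfl

@[simp]
theorem encodeCNF_cons (c : List Literal) (φ : CNF) :
    encodeCNF (c :: φ) = encodeClause c ++ encodeCNF φ := rfl

theorem encodeCNF_injective : Function.Injective encodeCNF := by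
  intro φ φ' h
  induction φ generalizing φ' with
  | nil =>
    cases φ' with
    | nil => rfl
    | cons c φ' => simp [encodeClause_ne_nil] at h
  | cons c φ ih =>
    cases φ' with
    | nil => simp [encodeClause_ne_nil] at h
    | cons c' φ' =>
      obtain ⟨rfl, h'⟩ := encodeClause_append_inj h
      rw [ih h']
theorem encodeCNF_mem_threeSAT_iff {φ : CNF} (h3 : φ.Is3CNF) :
    encodeCNF φ ∈ threeSAT ↔ φ.Satisfiable := by
  refine ⟨fun ⟨ψ, _, hψ, hcode⟩ => ?_, fun hφ => ⟨φ, h3, hφ, rfl⟩⟩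
  rwa [← encodeCNF_injective hcode]

theorem length_encodeClause_le {c : List Literal} {m : ℕ}
    (h : ∀ l ∈ c, (encodeLiteral l).length ≤ m) :
    (encodeClause c).length ≤ c.length * (m + 1) + 1 := by
  rw [encodeClause, List.length_append, List.length_flatMap, List.length_singleton]
  gcongr
  exact (List.sum_le_card_nsmul _ (m + 1) (List.forall_mem_map.2 fun l hl =>
    Nat.succ_le_succ (h l hl))).trans (by simp)

theorem length_encodeCNF_le {φ : CNF} {m : ℕ} (h : ∀ c ∈ φ, (encodeClause c).length ≤ m) :
    (encodeCNF φ).length ≤ φ.length * m := by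
  rw [encodeCNF, List.length_flatMap]
  exact (List.sum_le_card_nsmul _ m (List.forall_mem_map.2 h)).trans (by simp)

/-! ### Reduction of 3SATC to 3SAT -/

/-- Words whose length is fixed and each of whose bits depends on at most one of the bits `f`. -/
def IsProjectionWord {ι X : Type*} (f : ι → X → Bool) (w : X → List Bool) : Prop :=
  ∃ W : List (X → Bool), (∀ b ∈ W, IsJunta 1 f b) ∧ ∀ x, W.map (fun b => b x) = w x

namespace IsProjectionWord

variable {ι X : Type*} {f : ι → X → Bool} {w w' : X → List Bool}

theorem const (u : List Bool) : IsProjectionWord f fun _ => u :=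
  ⟨u.map fun b _ => b, List.forall_mem_map.2 fun _ _ => .of_forall_eq fun _ _ => rfl,
    by simp [Function.comp_def]⟩

theorem cons {b : X → Bool} (hb : IsJunta 1 f b) (h : IsProjectionWord f w) :
    IsProjectionWord f fun x => b x :: w x := by
  obtain ⟨W, hW, hw⟩ := h
  exact ⟨b :: W, List.forall_mem_cons.2 ⟨hb, hW⟩, fun x => congrArg _ (hw x)⟩

theorem append (h : IsProjectionWord f w) (h' : IsProjectionWord f w') :
    IsProjectionWord f fun x => w x ++ w' x := by
  obtain ⟨W, hW, hw⟩ := h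
  obtain ⟨W', hW', hw'⟩ := h'
  exact ⟨W ++ W', List.forall_mem_append.2 ⟨hW, hW'⟩, fun x => by rw [List.map_append, hw, hw']⟩

theorem flatMap {ι' : Type*} {w : ι' → X → List Bool} (l : List ι')
    (h : ∀ i, IsProjectionWord f (w i)) : IsProjectionWord f fun x => l.flatMap fun i => w i x := by
  induction l with
  | nil => exact const []
  | cons i l ih => simpa only [List.flatMap_cons] using (h i).append ih

theorem exists_isProjection {n N : ℕ} {w : (Fin n → Bool) → List Bool}
    (h : IsProjectionWord (fun j x => x j) w) (hN : ∀ x, (w x).length ≤ N) :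
    ∃ M ≤ N, ∃ π : (Fin n → Bool) → Fin M → Bool, IsProjection π ∧ ∀ x, List.ofFn (π x) = w x := by
  obtain ⟨W, hW, hw⟩ := h
  refine ⟨W.length, ?_, fun x i => W[i] x, fun i => hW _ (List.getElem_mem i.2), fun x => ?_⟩
  · simpa [← hw] using hN fun _ => false
  · rw [← hw]
    exact List.ext_getElem (by simp) (by simp)

end IsProjectionWord

/-- The literal replacing `l` in a disjunction with selection bit `c`. Variables with an odd number
stand for the original variables; those with an even number occur only positively, so that the
disjunctions that are not selected can be satisfied independently. -/
def guardLiteral (c : Bool) (l : Literal) : Literal := (Nat.bit c (l.1 + 1), l.2 || !c)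

/-- A formula whose satisfiability amounts to that of the conjunction of the disjunctions `cl j`
with `c j = true`, and the length of whose code does not depend on `c`. -/
def guardFormula {D : ℕ} (cl : Fin D → List Literal) (c : Fin D → Bool) : CNF :=
  (List.finRange D).map fun j => (cl j).map (guardLiteral (c j))

section GuardFormula

variable {D : ℕ} {cl : Fin D → List Literal}

theorem forall_mem_guardFormula {c : Fin D → Bool} {P : List Literal → Prop} :
    (∀ d ∈ guardFormula cl c, P d) ↔ ∀ j, P ((cl j).map (guardLiteral (c j))) := by
  simp [guardFormula]

theorem guardFormula_satisfiable_iff (hcl : ∀ j, cl j ≠ []) {c : Fin D → Bool} :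
    (guardFormula cl c).Satisfiable ↔
      ∃ σ : ℕ → Bool, ∀ j, c j = true → ∃ l ∈ cl j, Literal.Holds σ l := by
  simp only [CNF.Satisfiable, forall_mem_guardFormula, List.mem_map, exists_exists_and_eq_and]
  constructor
  · rintro ⟨τ, hτ⟩
    refine ⟨fun v => τ (Nat.bit true (v + 1)), fun j hc => (hτ j).imp fun l hl => ?_⟩
    simpa [Literal.Holds, guardLiteral, hc] using hl
  · rintro ⟨σ, hσ⟩
    refine ⟨fun m => !m.bodd || σ (m.div2 - 1), fun j => ?_⟩
    cases hc : c j with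
    | true =>
      refine (hσ j hc).imp fun l hl => hl.imp_right fun h => ?_
      simpa [Literal.Holds, guardLiteral] using h
    | false =>
      obtain ⟨l, hl⟩ := List.exists_mem_of_ne_nil _ (hcl j)
      exact ⟨l, hl, by simp [Literal.Holds, guardLiteral]⟩

theorem encodeLiteral_guardLiteral (c : Bool) (l : Literal) : encodeLiteral (guardLiteral c l) =
    (l.2 || !c) :: true :: c :: encodeDigits (l.1 + 1).bits := by
  simp [encodeLiteral_eq, guardLiteral]

theorem isProjectionWord_encodeCNF_guardFormula {ι X : Type*} {f : ι → X → Bool}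
    {c : Fin D → X → Bool} (hc : ∀ j, IsJunta 1 f (c j)) :
    IsProjectionWord f fun x => encodeCNF (guardFormula cl fun j => c j x) := by
  simp only [encodeCNF, guardFormula, List.flatMap_map, encodeClause, encodeLiteral_guardLiteral]
  refine .flatMap _ fun j => .append (.flatMap _ fun l => ?_) (.const _)
  have htrue : IsJunta 1 f fun _ => true := .of_forall_eq fun _ _ => rfl
  exact .cons htrue (.cons ((hc j).map fun b => l.2 || !b)
    (.cons htrue (.cons (hc j) (.const _))))

theorem length_encodeCNF_guardFormula_le {k : ℕ} (h3 : ∀ j, (cl j).length ≤ 3)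
    (hk : ∀ j, ∀ l ∈ cl j, l.1 < k) (c : Fin D → Bool) :
    (encodeCNF (guardFormula cl c)).length ≤ D * (3 * (2 * k + 5) + 1) := by
  have hclause : ∀ d ∈ guardFormula cl c, (encodeClause d).length ≤ 3 * (2 * k + 5) + 1 := by
    refine forall_mem_guardFormula.2 fun j => (length_encodeClause_le (m := 2 * k + 4) ?_).trans ?_
    · refine List.forall_mem_map.2 fun l hl => ?_
      have hvar := hk j l hl
      have hsize : (l.1 + 1).size ≤ l.1 + 1 := Nat.size_le.2 Nat.lt_two_pow_self
      simp only [encodeLiteral_guardLiteral, List.length_cons, length_encodeDigits,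
        Nat.size_eq_bits_len]
      omega
    · rw [List.length_map]
      gcongr
      exact h3 j
  simpa [guardFormula] using length_encodeCNF_le hclause

end GuardFormula

section DisjNumbering

variable (α : DisjNumbering)

/-- The disjunctions over the first `k` variables, in the order of the numbering `α`. -/
noncomputable def disjList (k : ℕ) (j : Fin (numDisj k)) : List Literal := (α.disj k j).toList

theorem disjList_ne_nil {k : ℕ} (j : Fin (numDisj k)) : disjList α k j ≠ [] := by
  have hcard := ((α.bijOn k).mapsTo j.2).2.1
  rw [disjList, Ne, Finset.toList_eq_nil]
  rintro hempty
  simp [hempty] at hcard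

theorem length_disjList_le {k : ℕ} (j : Fin (numDisj k)) : (disjList α k j).length ≤ 3 :=
  (Finset.length_toList _).trans_le ((α.bijOn k).mapsTo j.2).2.2

theorem lt_of_mem_disjList {k : ℕ} {j : Fin (numDisj k)} {l : Literal} (hl : l ∈ disjList α k j) :
    l.1 < k :=
  ((α.bijOn k).mapsTo j.2).1 l (Finset.mem_toList.1 hl)

theorem threeSATC_eq_true_iff {n : ℕ} (b : Fin n → Bool) :
    threeSATC α n b = true ↔ ∃ σ : ℕ → Bool, ∀ j : Fin (numDisj (numVars n)),
      b (j.castLE (numDisj_numVars_le n)) = true →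
        ∃ l ∈ disjList α (numVars n) j, Literal.Holds σ l := by
  simp only [threeSATC, decide_eq_true_iff, disjList, Finset.mem_toList]
  exact exists_congr fun σ => ⟨fun h j => h _ j.2, fun h i hi => h ⟨i, hi⟩⟩

theorem threeSATC_mem_PolySize (h : threeSAT ∈ PPoly) : threeSATC α ∈ PolySize := by
  have hN : PolyBound fun n => n * (3 * (2 * n + 5) + 1) :=
    PolyBound.id.mul (((PolyBound.const 3).mul
      (((PolyBound.const 2).mul .id).add (.const 5))).add (.const 1))
  refine mem_PolySize_of_projection (mem_PPoly_iff.1 h) hN fun n => ?_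
  have hD : numDisj (numVars n) ≤ n := numDisj_numVars_le n
  have hk : numVars n ≤ n := numDisj_strictMono.le_apply.trans hD
  let φ : (Fin n → Bool) → CNF := fun b =>
    guardFormula (disjList α (numVars n)) fun j => b (j.castLE hD)
  have h3 : ∀ b, (φ b).Is3CNF := fun b => forall_mem_guardFormula.2 fun j =>
    (List.length_map _).trans_le (length_disjList_le α j)
  have hlen : ∀ b, (encodeCNF (φ b)).length ≤ n * (3 * (2 * n + 5) + 1) := fun b =>
    (length_encodeCNF_guardFormula_le (length_disjList_le α)
      (fun _ _ => lt_of_mem_disjList α) _).trans (by gcongr)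
  have hword : IsProjectionWord (fun j (b : Fin n → Bool) => b j) fun b => encodeCNF (φ b) :=
    isProjectionWord_encodeCNF_guardFormula fun j => .of_apply (j.castLE hD) fun _ _ h => h
  obtain ⟨M, hM, π, hπ, hcode⟩ := hword.exists_isProjection hlen
  refine ⟨M, hM, π, hπ, fun b => Bool.eq_iff_iff.2 ?_⟩
  rw [charFamily_eq_true_iff, hcode, encodeCNF_mem_threeSAT_iff (h3 b),
    guardFormula_satisfiable_iff (disjList_ne_nil α), threeSATC_eq_true_iff]

end DisjNumbering

/-! ### A finite-state parser for annotated formulas -/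

/-- States of the parser: between clauses, in a clause with `c` literals read, before a sign, in the
digits of a literal, before a digit. The component `s` says whether the clause is already satisfied,
and `ok` whether the digits read so far do not end with `false`. -/
inductive ParseState where
  | start
  | clause (c : Fin 4) (s : Bool)
  | sign (c : Fin 3) (s : Bool)
  | digits (c : Fin 4) (s ok : Bool)
  | digit (c : Fin 4) (s : Bool)
  deriving DecidableEq, Fintype

/-- Transitions of the parser on reading a bit `x` with mark `m`. The mark of a sign is the value of
the variable. The output consists of the value of the variable and the digits of each literal. -/
def ParseState.next (x m : Bool) : ParseState → Option (ParseState × Option (Bool ⊕ Bool))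
  | .start => if x then some (.sign 0 false, none) else none
  | .clause c s =>
    if x then if h : (c : ℕ) < 3 then some (.sign ⟨c, h⟩ s, none) else none
    else if s then some (.start, none) else none
  | .sign c s => some (.digits c.succ (s || x == m) true, some (.inr m))
  | .digits c s ok =>
    if x then some (.digit c s, none) else if ok then some (.clause c s, none) else none
  | .digit c s => some (.digits c s x, some (.inl x))

/-- The output of the parser on a word of marked bits, if the word is accepted. -/
def parse : ParseState → List (Bool × Bool) → Option (List (Bool ⊕ Bool))
  | p, [] => if p = .start then some [] else none
  | p, (x, m) :: z =>
    match p.next x m with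
    | none => none
    | some (p', o) => (parse p' z).map (o.toList ++ ·)

/-- Digit lists without leading zeros. -/
def CanonicalDigits (d : List Bool) : Prop := d.getLast? ≠ some false

theorem CanonicalDigits.tail {b : Bool} {d : List Bool} (h : CanonicalDigits (b :: d)) :
    CanonicalDigits d ∧ (d = [] → b = true) := by
  cases d with
  | nil => cases b <;> simp_all [CanonicalDigits]
  | cons c d => simpa [CanonicalDigits] using h

theorem CanonicalDigits.cons {b : Bool} {d : List Bool} (h : CanonicalDigits d)
    (hb : d = [] → b = true) : CanonicalDigits (b :: d) := by
  cases d with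
  | nil => simp_all [CanonicalDigits]
  | cons c d => simpa [CanonicalDigits] using h

theorem CanonicalDigits.bits_ofDigits {d : List Bool} (h : CanonicalDigits d) :
    (ofDigits d).bits = d := by
  induction d with
  | nil => simp [ofDigits]
  | cons b d ih =>
    obtain ⟨hd, hb⟩ := h.tail
    change (Nat.bit b (ofDigits d)).bits = b :: d
    rw [Nat.bits_append_bit _ _ fun hz => hb (by simpa [hz] using (ih hd).symm), ih hd]

theorem canonicalDigits_bits (n : ℕ) : CanonicalDigits n.bits := by
  induction n using Nat.binaryRec' with
  | zero => simp [CanonicalDigits]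
  | bit b n h ih =>
    rw [Nat.bits_append_bit n b h]
    refine ih.cons fun hn => h ?_
    rw [← ofDigits_bits n, hn]
    rfl

/-- An occurrence of a literal, given by the digits of its variable and its sign, together with a
truth value claimed for the variable. -/
structure MarkedLiteral where
  digits : List Bool
  sign : Bool
  value : Bool

/-- The literal of an occurrence. -/
def MarkedLiteral.toLiteral (l : MarkedLiteral) : Literal := (ofDigits l.digits, l.sign)

/-- Code of a clause given by literal occurrences. -/
def encodeMarked (c : List MarkedLiteral) : List Bool :=
  c.flatMap (fun l => true :: l.sign :: encodeDigits l.digits) ++ [false]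

/-- Output of the parser for a list of literal occurrences. -/
def markedOutput (c : List MarkedLiteral) : List (Bool ⊕ Bool) :=
  c.flatMap fun l => .inr l.value :: l.digits.map .inl

/-- Clauses with at most three literals of which one is true under the marked values. -/
def GoodClause (c : List MarkedLiteral) : Prop :=
  c.length ≤ 3 ∧ (∀ l ∈ c, CanonicalDigits l.digits) ∧ ∃ l ∈ c, l.sign = l.value

/-- Words and outputs for accepted remainders of a formula between clauses. -/
def AcceptsRest (xs : List Bool) (E : List (Bool ⊕ Bool)) : Prop :=
  ∃ r : List (List MarkedLiteral), xs = r.flatMap encodeMarked ∧ E = markedOutput r.flatten ∧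
    ∀ c ∈ r, GoodClause c

/-- Words and outputs for accepted remainders of a formula within a clause. -/
def AcceptsClause (n : ℕ) (s : Bool) (xs : List Bool) (E : List (Bool ⊕ Bool)) : Prop :=
  ∃ (c : List MarkedLiteral) (xs' : List Bool) (E' : List (Bool ⊕ Bool)),
    xs = encodeMarked c ++ xs' ∧ E = markedOutput c ++ E' ∧ AcceptsRest xs' E' ∧
    c.length + n ≤ 3 ∧ (∀ l ∈ c, CanonicalDigits l.digits) ∧ (s = true ∨ ∃ l ∈ c, l.sign = l.value)

/-- Words and outputs accepted from a state of the parser. -/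
def ParseState.Accepts : ParseState → List Bool → List (Bool ⊕ Bool) → Prop
  | .start, xs, E => AcceptsRest xs E
  | .clause c s, xs, E => AcceptsClause c s xs E
  | .sign c s, xs, E => ∃ d g m xs' E', xs = g :: (encodeDigits d ++ xs') ∧
      E = .inr m :: (d.map .inl ++ E') ∧ CanonicalDigits d ∧
      AcceptsClause (c + 1) (s || g == m) xs' E'
  | .digits c s ok, xs, E => ∃ d xs' E', xs = encodeDigits d ++ xs' ∧ E = d.map .inl ++ E' ∧
      CanonicalDigits d ∧ (d = [] → ok = true) ∧ AcceptsClause c s xs' E'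
  | .digit c s, xs, E => ∃ b d xs' E', xs = b :: (encodeDigits d ++ xs') ∧
      E = .inl b :: (d.map .inl ++ E') ∧ CanonicalDigits d ∧ (d = [] → b = true) ∧
      AcceptsClause c s xs' E'

theorem AcceptsClause.cons {n : ℕ} {s : Bool} {xs' : List Bool} {E' : List (Bool ⊕ Bool)}
    {d : List Bool} {g m : Bool} (hd : CanonicalDigits d)
    (h : AcceptsClause (n + 1) (s || g == m) xs' E') :
    AcceptsClause n s (true :: g :: (encodeDigits d ++ xs')) (.inr m :: (d.map .inl ++ E')) := by
  obtain ⟨c, ys, F, rfl, rfl, hr, hl, hc, hs⟩ := h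
  refine ⟨⟨d, g, m⟩ :: c, ys, F, by simp [encodeMarked], by simp [markedOutput], hr,
    by simp only [List.length_cons]; omega, List.forall_mem_cons.2 ⟨hd, hc⟩, ?_⟩
  rcases hs with hs | ⟨l, hl, h⟩
  · rw [Bool.or_eq_true, beq_iff_eq] at hs
    exact hs.imp id fun h => ⟨_, List.mem_cons_self, h⟩
  · exact .inr ⟨l, List.mem_cons_of_mem _ hl, h⟩

theorem AcceptsClause.acceptsRest {xs : List Bool} {E : List (Bool ⊕ Bool)}
    (h : AcceptsClause 0 false xs E) : AcceptsRest xs E := by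
  obtain ⟨c, _, _, rfl, rfl, ⟨r, rfl, rfl, hr⟩, hl, hc, hs⟩ := h
  refine ⟨c :: r, by simp, by simp [markedOutput], ?_⟩
  simpa using ⟨⟨hl, hc, by simpa using hs⟩, hr⟩

theorem ParseState.Accepts.of_next {p q : ParseState} {x m : Bool} {o : Option (Bool ⊕ Bool)}
    {xs : List Bool} {E : List (Bool ⊕ Bool)} (hp : p.next x m = some (q, o))
    (h : q.Accepts xs E) : p.Accepts (x :: xs) (o.toList ++ E) := by
  cases p with
  | start =>
    obtain ⟨rfl, rfl, rfl⟩ : x = true ∧ .sign 0 false = q ∧ none = o := by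
      simpa [ParseState.next] using hp
    obtain ⟨d, g, m, xs', E', rfl, rfl, hd, hc⟩ := h
    exact (AcceptsClause.cons hd (by simpa using hc)).acceptsRest
  | clause c s =>
    cases x with
    | true =>
      obtain ⟨hc3, rfl, rfl⟩ : ∃ hc : (c : ℕ) < 3, .sign ⟨c, hc⟩ s = q ∧ none = o := by
        simpa [ParseState.next] using hp
      obtain ⟨d, g, m, xs', E', rfl, rfl, hd, hc⟩ := h
      exact AcceptsClause.cons hd hc
    | false =>
      obtain ⟨hs, rfl, rfl⟩ : s = true ∧ .start = q ∧ none = o := by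
        simpa [ParseState.next] using hp
      exact ⟨[], _, _, rfl, rfl, h, by simpa using Fin.is_le c, by simp, .inl hs⟩
  | sign c s =>
    obtain ⟨rfl, rfl⟩ : .digits c.succ (s || x == m) true = q ∧ some (.inr m) = o := by
      simpa [ParseState.next] using hp
    obtain ⟨d, xs', E', rfl, rfl, hd, -, hc⟩ := h
    exact ⟨d, x, m, xs', E', rfl, rfl, hd, hc⟩
  | digits c s ok =>
    cases x with
    | true =>
      obtain ⟨rfl, rfl⟩ : .digit c s = q ∧ none = o := by simpa [ParseState.next] using hp
      obtain ⟨b, d, xs', E', rfl, rfl, hd, hb, hc⟩ := h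
      exact ⟨b :: d, xs', E', by simp, by simp, hd.cons hb, by simp, hc⟩
    | false =>
      obtain ⟨hok, rfl, rfl⟩ : ok = true ∧ .clause c s = q ∧ none = o := by
        simpa [ParseState.next] using hp
      exact ⟨[], xs, E, by simp, by simp, by simp [CanonicalDigits], fun _ => hok, h⟩
  | digit c s =>
    obtain ⟨rfl, rfl⟩ : .digits c s x = q ∧ some (.inl x) = o := by
      simpa [ParseState.next] using hp
    obtain ⟨d, xs', E', rfl, rfl, hd, hx, hc⟩ := h
    exact ⟨x, d, xs', E', rfl, rfl, hd, hx, hc⟩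

theorem parse_sound {p : ParseState} {z : List (Bool × Bool)} {E : List (Bool ⊕ Bool)}
    (h : parse p z = some E) : p.Accepts (z.map Prod.fst) E := by
  induction z generalizing p E with
  | nil =>
    obtain ⟨rfl, rfl⟩ : p = .start ∧ [] = E := by simpa [parse] using h
    exact ⟨[], rfl, rfl, by simp⟩
  | cons a z ih =>
    obtain ⟨x, m⟩ := a
    simp only [parse] at h
    cases hp : p.next x m with
    | none => simp [hp] at h
    | some q =>
      simp only [hp, Option.map_eq_some_iff] at h
      obtain ⟨E, hE, rfl⟩ := h
      exact .of_next hp (ih hE)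

theorem parse_digits (c : Fin 4) (s ok : Bool) {d : List Bool} (hd : CanonicalDigits d)
    (hok : d = [] → ok = true) (z : List (Bool × Bool)) :
    parse (.digits c s ok) ((encodeDigits d).map (·, false) ++ z) =
      (parse (.clause c s) z).map (d.map .inl ++ ·) := by
  induction d generalizing ok with
  | nil => simp [parse, ParseState.next, hok]
  | cons b d ih =>
    obtain ⟨hd, hb⟩ := hd.tail
    simp [parse, ParseState.next, ih b hd hb, Function.comp_def]

/-- The marked code of a clause under an assignment. -/
def markClause (σ : ℕ → Bool) (c : List Literal) : List (Bool × Bool) :=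
  c.flatMap (fun l => (true, false) :: (l.2, σ l.1) :: (encodeDigits l.1.bits).map (·, false)) ++
    [(false, false)]

/-- The occurrence of a literal with the value of its variable under an assignment. -/
def markLiteral (σ : ℕ → Bool) (l : Literal) : MarkedLiteral := ⟨l.1.bits, l.2, σ l.1⟩

theorem parse_markClause (σ : ℕ → Bool) (n : Fin 4) (s : Bool) (c : List Literal)
    (hn : c.length + n ≤ 3) (hs : s = true ∨ ∃ l ∈ c, Literal.Holds σ l)
    (z : List (Bool × Bool)) :
    parse (.clause n s) (markClause σ c ++ z) =
      (parse .start z).map (markedOutput (c.map (markLiteral σ)) ++ ·) := by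
  induction c generalizing n s with
  | nil =>
    have hs : s = true := by simpa using hs
    simp [markClause, parse, ParseState.next, hs, markedOutput]
  | cons l c ih =>
    have hn3 : (n : ℕ) < 3 := by simp only [List.length_cons] at hn; omega
    have h1 : markClause σ (l :: c) ++ z = (true, false) :: (l.2, σ l.1) ::
        ((encodeDigits l.1.bits).map (·, false) ++ (markClause σ c ++ z)) := by
      simp [markClause]
    rw [h1]
    simp only [parse, ParseState.next, if_true, dif_pos hn3]
    rw [parse_digits _ _ _ (canonicalDigits_bits _) (fun _ => rfl), ih]
    · simp [Function.comp_def, markedOutput, markLiteral]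
    · simp only [List.length_cons, Fin.val_succ] at hn ⊢
      omega
    · rcases hs with rfl | ⟨l', hl', h⟩
      · exact .inl rfl
      · rcases List.mem_cons.1 hl' with rfl | hl'
        · exact .inl (by simp [show σ l'.1 = l'.2 from h])
        · exact .inr ⟨l', hl', h⟩

theorem parse_complete (σ : ℕ → Bool) (φ : CNF) (h3 : φ.Is3CNF)
    (hs : ∀ c ∈ φ, ∃ l ∈ c, Literal.Holds σ l) :
    parse .start (φ.flatMap (markClause σ)) =
      some (markedOutput ((φ.flatten).map (markLiteral σ))) := by
  induction φ with
  | nil => simp [parse, markedOutput]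
  | cons c φ ih =>
    have h0 : ∀ z, parse .start (markClause σ c ++ z) = parse (.clause 0 false)
        (markClause σ c ++ z) := by
      obtain ⟨l, hl, -⟩ := hs c (by simp)
      intro z
      cases c with
      | nil => simp at hl
      | cons l c => simp [markClause, parse, ParseState.next]
    rw [List.flatMap_cons, h0, parse_markClause, ih]
    · simp [markedOutput]
    · exact fun d hd => h3 d (by simp [hd])
    · exact fun d hd => hs d (by simp [hd])
    · simpa using h3 c (by simp)
    · exact .inr (hs c (by simp))

theorem map_fst_markClause (σ : ℕ → Bool) (φ : CNF) :
    (φ.flatMap (markClause σ)).map Prod.fst = encodeCNF φ := by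
  unfold encodeCNF
  rw [List.map_flatMap]
  congr 1
  funext c
  simp [markClause, encodeClause, List.map_flatMap, encodeLiteral_eq, Function.comp_def]

/-! ### Verification of annotated formulas -/

/-- Blocks consisting of the reversed digits and the value of a variable, as stack content. -/
def blockSymbols (B : List (List Bool × Bool)) : List (Bool ⊕ Bool) :=
  B.flatMap fun b => b.1.map .inl ++ [.inr b.2]

@[simp]
theorem blockSymbols_cons (b : List Bool × Bool) (B : List (List Bool × Bool)) :
    blockSymbols (b :: B) = b.1.map .inl ++ .inr b.2 :: blockSymbols B := by
  simp [blockSymbols]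

theorem map_inl_append_inj {d d' : List Bool} {m m' : Bool} {r r' : List (Bool ⊕ Bool)}
    (h : d.map Sum.inl ++ .inr m :: r = d'.map Sum.inl ++ .inr m' :: r') :
    d = d' ∧ m = m' ∧ r = r' := by
  induction d generalizing d' with
  | nil => cases d' <;> simp_all
  | cons b d ih =>
    cases d' with
    | nil => simp at h
    | cons b' d' =>
      simp only [List.map_cons, List.cons_append, List.cons.injEq, Sum.inl.injEq] at h
      obtain ⟨rfl, h⟩ := h
      obtain ⟨rfl, rfl, rfl⟩ := ih h
      exact ⟨rfl, rfl, rfl⟩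

theorem blockSymbols_injective : Function.Injective blockSymbols := by
  intro B B' h
  induction B generalizing B' with
  | nil =>
    cases B' with
    | nil => rfl
    | cons b B' => simp [blockSymbols] at h
  | cons b B ih =>
    cases B' with
    | nil => simp [blockSymbols] at h
    | cons b' B' =>
      simp only [blockSymbols_cons] at h
      obtain ⟨h1, h2, h3⟩ := map_inl_append_inj h
      rw [ih h3, Prod.ext h1 h2]

/-- The blocks of a list of literal occurrences. -/
def markedBlocks (c : List MarkedLiteral) : List (List Bool × Bool) :=
  (c.map fun l => (l.digits.reverse, l.value)).reverse

theorem reverse_markedOutput (c : List MarkedLiteral) :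
    (markedOutput c).reverse = blockSymbols (markedBlocks c) := by
  induction c with
  | nil => rfl
  | cons l c ih =>
    have h1 : markedOutput (l :: c) = .inr l.value :: (l.digits.map .inl ++ markedOutput c) := by
      simp [markedOutput]
    rw [h1, List.reverse_cons, List.reverse_append, ih]
    simp [markedBlocks, blockSymbols]

/-- Equal variables have equal values. -/
def ConsistentBlocks (B : List (List Bool × Bool)) : Prop :=
  B.Pairwise fun p q => q.1 = p.1 → q.2 = p.2

open Classical in
/-- The verifier for 3SAT: the certificate lists the values of the variables at the positions of the
signs of literals, in reverse order. -/
noncomputable def verify (x u : List Bool) : Bool :=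
  decide (∃ B, parse .start (x.reverse.zip u).reverse = some (blockSymbols B).reverse ∧
    ConsistentBlocks B)

theorem verify_eq_false {x u : List Bool} (h : parse .start (x.reverse.zip u).reverse = none) :
    verify x u = false := by
  simp [verify, h]

theorem verify_eq_true_iff {x u : List Bool} {B : List (List Bool × Bool)}
    (h : parse .start (x.reverse.zip u).reverse = some (blockSymbols B).reverse) :
    verify x u = true ↔ ConsistentBlocks B := by
  simp [verify, h, blockSymbols_injective.eq_iff]

theorem parse_eq_blocks {z : List (Bool × Bool)} {E : List (Bool ⊕ Bool)}
    (h : parse .start z = some E) : ∃ B, E = (blockSymbols B).reverse := by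
  obtain ⟨r, -, rfl, -⟩ := parse_sound h
  exact ⟨_, by rw [← reverse_markedOutput, List.reverse_reverse]⟩

theorem exists_parse_of_mem_threeSAT {x : List Bool} (hx : x ∈ threeSAT) :
    ∃ z : List (Bool × Bool), z.map Prod.fst = x ∧
      ∃ B, parse .start z = some (blockSymbols B).reverse ∧ ConsistentBlocks B := by
  obtain ⟨φ, h3, ⟨σ, hσ⟩, rfl⟩ := hx
  refine ⟨φ.flatMap (markClause σ), map_fst_markClause σ φ,
    markedBlocks (φ.flatten.map (markLiteral σ)), ?_, ?_⟩
  · rw [parse_complete σ φ h3 hσ, ← reverse_markedOutput, List.reverse_reverse]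
  · refine List.pairwise_of_forall_mem_list fun p hp q hq h => ?_
    simp only [markedBlocks, markLiteral, List.map_map, List.mem_reverse, List.mem_map,
      Function.comp_apply] at hp hq
    obtain ⟨l, -, rfl⟩ := hp
    obtain ⟨l', -, rfl⟩ := hq
    simp only [List.reverse_inj] at h ⊢
    rw [← ofDigits_bits l.1, ← ofDigits_bits l'.1, h]

theorem ConsistentBlocks.eq_of_mem {B : List (List Bool × Bool)} (hB : ConsistentBlocks B)
    {d : List Bool} {m m' : Bool} (h : (d, m) ∈ B) (h' : (d, m') ∈ B) : m = m' := by
  have : Std.Symm fun p q : List Bool × Bool => q.1 = p.1 → q.2 = p.2 :=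
    ⟨fun p q h h' => (h h'.symm).symm⟩
  exact (List.Pairwise.forall_of_forall (fun _ _ _ => rfl) hB h h' rfl).symm

/-- The assignment read off from blocks; variables without a block are false. -/
def blockAssignment (B : List (List Bool × Bool)) (v : ℕ) : Bool := (v.bits.reverse, true) ∈ B

theorem ConsistentBlocks.blockAssignment_ofDigits {B : List (List Bool × Bool)}
    (hB : ConsistentBlocks B) {d : List Bool} {m : Bool} (hd : CanonicalDigits d)
    (h : (d.reverse, m) ∈ B) : blockAssignment B (ofDigits d) = m := by
  rw [blockAssignment, hd.bits_ofDigits]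
  cases m with
  | true => exact decide_eq_true h
  | false => exact decide_eq_false fun h' => Bool.false_ne_true (hB.eq_of_mem h h')

theorem encodeCNF_map_toLiteral {r : List (List MarkedLiteral)}
    (hr : ∀ c ∈ r, ∀ l ∈ c, CanonicalDigits l.digits) :
    encodeCNF (r.map (List.map MarkedLiteral.toLiteral)) = r.flatMap encodeMarked := by
  rw [encodeCNF, List.flatMap_map]
  refine List.flatMap_congr fun c hc => ?_
  rw [encodeClause, encodeMarked, List.flatMap_map]
  congr 1
  refine List.flatMap_congr fun l hl => ?_
  simp [encodeLiteral_eq, MarkedLiteral.toLiteral, (hr c hc l hl).bits_ofDigits]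

theorem mem_threeSAT_of_parse {z : List (Bool × Bool)} {B : List (List Bool × Bool)}
    (h : parse .start z = some (blockSymbols B).reverse) (hB : ConsistentBlocks B) :
    z.map Prod.fst ∈ threeSAT := by
  obtain ⟨r, hx, hE, hr⟩ := parse_sound h
  obtain rfl : B = markedBlocks r.flatten :=
    blockSymbols_injective (by rw [← reverse_markedOutput, ← hE, List.reverse_reverse])
  rw [hx, ← encodeCNF_map_toLiteral fun c hc => (hr c hc).2.1]
  refine ⟨_, List.forall_mem_map.2 fun c hc => ?_,
    ⟨blockAssignment (markedBlocks r.flatten), List.forall_mem_map.2 fun c hc => ?_⟩, rfl⟩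
  · simpa using (hr c hc).1
  · obtain ⟨-, hcan, l, hl, hsign⟩ := hr c hc
    refine ⟨l.toLiteral, List.mem_map_of_mem hl, ?_⟩
    have hmem : (l.digits.reverse, l.value) ∈ markedBlocks r.flatten :=
      List.mem_reverse.2 (List.mem_map.2 ⟨l, List.mem_flatten_of_mem hc hl, rfl⟩)
    exact (hB.blockAssignment_ofDigits (hcan l hl) hmem).trans hsign.symm

theorem mem_threeSAT_iff_verify (x : List Bool) :
    x ∈ threeSAT ↔ ∃ u : List Bool, u.length = x.length ∧ verify x u = true := by
  simp only [verify, decide_eq_true_iff]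
  constructor
  · intro hx
    obtain ⟨z, rfl, hB⟩ := exists_parse_of_mem_threeSAT hx
    refine ⟨(z.map Prod.snd).reverse, by simp, ?_⟩
    have : ((z.map Prod.fst).reverse.zip (z.map Prod.snd).reverse).reverse = z := by
      rw [← List.map_reverse, ← List.map_reverse, List.zip_map']
      simp
    rwa [this]
  · rintro ⟨u, hu, B, h, hB⟩
    have := mem_threeSAT_of_parse h hB
    rwa [List.map_reverse, List.map_fst_zip (by simp [hu]), List.reverse_reverse] at this

/-! ### A stack machine deciding the verifier -/

namespace Verifier

/-- Working stacks: `inp` holds the input, `arg` the reversed word, `zip` the marked word, `word`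
the blocks still to be examined, `cur` and `ref` the digits of the block being examined, and `done`
the blocks it has been compared with. -/
inductive Reg where
  | inp | arg | zip | word | cur | ref | done
  deriving DecidableEq

instance : Fintype Reg :=
  ⟨{.inp, .arg, .zip, .word, .cur, .ref, .done}, fun r => by cases r <;> decide⟩

/-- Contents of the working stacks, with the top of each stack first. -/
structure Regs where
  inp : List (Bool ⊕ Bool)
  arg : List (Bool ⊕ Bool)
  zip : List (Bool ⊕ Bool)
  word : List (Bool ⊕ Bool)
  cur : List (Bool ⊕ Bool)
  ref : List (Bool ⊕ Bool)
  done : List (Bool ⊕ Bool)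

/-- The content of the stack `r`. -/
def Regs.get (S : Regs) : Reg → List (Bool ⊕ Bool)
  | .inp => S.inp
  | .arg => S.arg
  | .zip => S.zip
  | .word => S.word
  | .cur => S.cur
  | .ref => S.ref
  | .done => S.done

/-- The stacks with the content of `r` replaced by `L`. -/
def Regs.set (S : Regs) (r : Reg) (L : List (Bool ⊕ Bool)) : Regs :=
  match r with
  | .inp => { S with inp := L }
  | .arg => { S with arg := L }
  | .zip => { S with zip := L }
  | .word => { S with word := L }
  | .cur => { S with cur := L }
  | .ref => { S with ref := L }
  | .done => { S with done := L }

/-- The total height of the stacks. -/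
def Regs.size (S : Regs) : ℕ :=
  S.inp.length + S.arg.length + S.zip.length + S.word.length + S.cur.length + S.ref.length +
    S.done.length

theorem Regs.size_set (S : Regs) (r : Reg) (L : List (Bool ⊕ Bool)) :
    (S.set r L).size + (S.get r).length = S.size + L.length := by
  cases r <;> simp only [Regs.set, Regs.get, Regs.size] <;> omega

theorem Regs.get_set_self (S : Regs) (r : Reg) (L : List (Bool ⊕ Bool)) :
    (S.set r L).get r = L := by
  cases r <;> rfl

theorem Regs.set_set (S : Regs) (r : Reg) (L L' : List (Bool ⊕ Bool)) :
    (S.set r L).set r L' = S.set r L' := by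
  cases r <;> rfl

/-- Labels: `read` and `pair` combine word and certificate, `parse` runs the parser, `take` and
`restore` fetch a block, `digit`, `compare` and `rest` compare it with the other blocks, `back`
and `clear` prepare the next round, `clean` empties the stacks. -/
inductive Label where
  | read | pair | parse | take | restore | digit | compare | rest | back | clear
  | clean (r : Reg)
  | finish
  deriving DecidableEq, Fintype

/-- Local variables: parser state, value of the fetched block, symbol read last, result of the
comparison of digits, answer. -/
structure Vars where
  state : ParseState
  value : Bool
  bit : Bool
  same : Bool
  answer : Bool
  deriving Fintype

/-- The stack popped at a label. -/
def source : Label → Reg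
  | .read => .inp
  | .pair => .arg
  | .parse => .zip
  | .take => .word
  | .restore => .cur
  | .digit => .word
  | .compare => .ref
  | .rest => .ref
  | .back => .done
  | .clear => .ref
  | .clean r => r
  | .finish => .inp

/-- The stack pushed at a label. -/
def target : Label → Reg
  | .read => .arg
  | .pair => .zip
  | .parse => .word
  | .take => .cur
  | .restore => .ref
  | .digit => .done
  | .compare => .cur
  | .rest => .cur
  | .back => .word
  | .clear => .ref
  | .clean r => r
  | .finish => .inp

/-- A bit with a mark as a stack symbol. -/
def pairSymbol (a : Bool × Bool) : Bool ⊕ Bool := if a.2 then .inr a.1 else .inl a.1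

/-- The label after emptying a stack. -/
def cleanNext : Reg → Label
  | .inp => .clean .arg
  | .arg => .clean .zip
  | .zip => .clean .word
  | .word => .clean .cur
  | .cur => .clean .ref
  | .ref => .clean .done
  | .done => .finish

/-- Transitions: next label, new values of the variables, symbol to be pushed. -/
def transition : Label → Vars → Option (Bool ⊕ Bool) → Label × Vars × Option (Bool ⊕ Bool)
  | .read, v, some (.inl b) => (.read, v, some (.inl b))
  | .read, v, some (.inr m) => (.pair, { v with bit := m }, none)
  | .read, v, none => (.parse, v, none)
  | .pair, v, some s => (.read, v, some (pairSymbol (s.elim id id, v.bit)))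
  | .pair, v, none => (.read, v, none)
  | .parse, v, some s =>
    match v.state.next (s.elim id id) s.isRight with
    | none => (.clean .inp, { v with answer := false }, none)
    | some (p, o) => (.parse, { v with state := p }, o)
  | .parse, v, none =>
    (bif decide (v.state = .start) then .take else .clean .inp, { v with answer := false }, none)
  | .take, v, some (.inl b) => (.take, v, some (.inl b))
  | .take, v, some (.inr m) => (.restore, { v with value := m }, none)
  | .take, v, none => (.clean .inp, { v with answer := true }, none)
  | .restore, v, some s => (.restore, v, some s)
  | .restore, v, none => (.digit, { v with same := true }, none)
  | .digit, v, some (.inl b) => (.compare, { v with bit := b }, some (.inl b))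
  | .digit, v, some (.inr m) => (.rest, { v with bit := m }, some (.inr m))
  | .digit, v, none => (.back, v, none)
  | .compare, v, some s => (.digit, { v with same := v.same && s == .inl v.bit }, some s)
  | .compare, v, none => (.digit, { v with same := false }, none)
  | .rest, v, some s => (.rest, { v with same := false }, some s)
  | .rest, v, none =>
    (bif v.same && v.value != v.bit then .clean .inp else .restore, { v with answer := false },
      none)
  | .back, v, some s => (.back, v, some s)
  | .back, v, none => (.clear, v, none)
  | .clear, v, some _ => (.clear, v, none)
  | .clear, v, none => (.take, v, none)
  | .clean r, v, some _ => (.clean r, v, none)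
  | .clean r, v, none => (cleanNext r, v, none)
  | .finish, v, _ => (.finish, v, none)

theorem transition_none (l : Label) (v : Vars) : (transition l v none).2.2 = none := by
  cases l <;> rfl

/-- Configurations of the machine, without its output stack. -/
abbrev Conf : Type := Label × Vars × Regs

/-- The stacks after popping `r` and pushing at most one symbol on `r'`. -/
def Regs.move (S : Regs) (r r' : Reg) (o : Option (Bool ⊕ Bool)) : Regs :=
  match o with
  | none => S.set r (S.get r).tail
  | some s => (S.set r (S.get r).tail).set r' (s :: (S.set r (S.get r).tail).get r')

/-- One step of the machine, with `finish` as a fixed point. -/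
def step : Conf → Conf
  | (.finish, v, S) => (.finish, v, S)
  | (l, v, S) =>
    let t := transition l v (S.get (source l)).head?
    (t.1, t.2.1, S.move (source l) (target l) t.2.2)

/-- Reachability within `t` steps. -/
def Reach (t : ℕ) (c c' : Conf) : Prop := ∃ s ≤ t, step^[s] c = c'

theorem Reach.refl (t : ℕ) (c : Conf) : Reach t c c := ⟨0, Nat.zero_le t, rfl⟩

theorem Reach.mono {t t' : ℕ} {c c' : Conf} (h : Reach t c c') (ht : t ≤ t') : Reach t' c c' :=
  h.imp fun _ hs => ⟨hs.1.trans ht, hs.2⟩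

theorem Reach.trans {t t' : ℕ} {c c' c'' : Conf} (h : Reach t c c') (h' : Reach t' c' c'') :
    Reach (t + t') c c'' := by
  obtain ⟨s, hs, rfl⟩ := h
  obtain ⟨s', hs', rfl⟩ := h'
  exact ⟨s' + s, by omega, by rw [Function.iterate_add_apply]⟩

theorem Reach.head {t : ℕ} {c c₁ c' : Conf} (h : Reach t c₁ c') (hc : step c = c₁ := by rfl) :
    Reach (t + 1) c c' := by
  obtain ⟨s, hs, rfl⟩ := h
  exact ⟨s + 1, by omega, by rw [Function.iterate_succ_apply, hc]⟩

theorem step_of_ne_finish {l : Label} (hl : l ≠ .finish) (v : Vars) (S : Regs) :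
    step (l, v, S) = ((transition l v (S.get (source l)).head?).1,
      (transition l v (S.get (source l)).head?).2.1,
      S.move (source l) (target l) (transition l v (S.get (source l)).head?).2.2) := by
  cases l <;> first | rfl | exact absurd rfl hl

theorem Regs.size_move_le (S : Regs) (r r' : Reg) {o : Option (Bool ⊕ Bool)}
    (ho : S.get r = [] → o = none) : (S.move r r' o).size ≤ S.size := by
  have hpop := S.size_set r (S.get r).tail
  cases o with
  | none =>
    simp only [Regs.move, List.length_tail] at hpop ⊢
    omega
  | some s =>
    have hpush := (S.set r (S.get r).tail).size_set r' (s :: (S.set r (S.get r).tail).get r')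
    have hpos : 0 < (S.get r).length := List.length_pos_iff.2 fun h => by simpa using ho h
    simp only [Regs.move, List.length_tail, List.length_cons] at hpop hpush ⊢
    omega

theorem size_step_le (c : Conf) : (step c).2.2.size ≤ c.2.2.size := by
  obtain ⟨l, v, S⟩ := c
  by_cases hl : l = .finish
  · subst hl
    rfl
  · rw [step_of_ne_finish hl]
    exact S.size_move_le _ _ fun h => by rw [h, List.head?_nil, transition_none]

theorem Reach.size_le {t : ℕ} {c c' : Conf} (h : Reach t c c') : c'.2.2.size ≤ c.2.2.size := by
  obtain ⟨s, -, rfl⟩ := h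
  induction s with
  | zero => exact le_rfl
  | succ s ih =>
    rw [Function.iterate_succ_apply']
    exact (size_step_le _).trans ih

theorem reach_clean_one (r : Reg) (v : Vars) (S : Regs) :
    Reach ((S.get r).length + 1) (.clean r, v, S) (cleanNext r, v, S.set r []) := by
  generalize hL : S.get r = L
  induction L generalizing S with
  | nil =>
    refine Reach.head (Reach.refl _ _) ?_
    simp [step_of_ne_finish, transition, source, hL, Regs.move]
  | cons s L ih =>
    have h := ih (S.set r L) (Regs.get_set_self _ _ _)
    rw [Regs.set_set] at h
    refine Reach.head h ?_
    simp [step_of_ne_finish, transition, source, hL, Regs.move]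

/-- Empty stacks. -/
def Regs.empty : Regs := ⟨[], [], [], [], [], [], []⟩

theorem reach_clean (v : Vars) (S : Regs) :
    Reach (S.size + 7) (.clean .inp, v, S) (.finish, v, .empty) := by
  have h := (((((reach_clean_one .inp v S).trans (reach_clean_one .arg v _)).trans
    (reach_clean_one .zip v _)).trans (reach_clean_one .word v _)).trans
    (reach_clean_one .cur v _)).trans (reach_clean_one .ref v _)
  refine (h.trans (reach_clean_one .done v _)).mono ?_
  simp only [Regs.get, Regs.set, Regs.size]
  omega

section Stacks

variable (i a z w e f y : List (Bool ⊕ Bool)) (v : Vars)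

theorem reach_read_word (d : List Bool) (r : List (Bool ⊕ Bool)) :
    Reach d.length (.read, v, ⟨d.map .inl ++ r, a, z, w, e, f, y⟩)
      (.read, v, ⟨r, d.reverse.map .inl ++ a, z, w, e, f, y⟩) := by
  induction d generalizing a with
  | nil => exact Reach.refl _ _
  | cons b d ih =>
    have h := ih (.inl b :: a)
    simp only [List.map_cons, List.length_cons, List.reverse_cons, List.append_assoc,
      List.cons_append, List.nil_append, List.map_append, List.map_nil]
    exact h.head

theorem reach_read_certificate (u a : List Bool) :
    ∃ b a', Reach (2 * u.length + 1) (.read, v, ⟨u.map .inr, a.map .inl, z, w, e, f, y⟩)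
      (.parse, { v with bit := b },
        ⟨[], a', ((a.zip u).reverse).map pairSymbol ++ z, w, e, f, y⟩) := by
  induction u generalizing a z v with
  | nil =>
    refine ⟨v.bit, a.map .inl, ?_⟩
    simp only [List.zip_nil_right, List.reverse_nil, List.map_nil, List.nil_append]
    exact (Reach.refl 0 _).head
  | cons m u ih =>
    cases a with
    | nil =>
      obtain ⟨b, a', h⟩ := ih (z := z) (v := { v with bit := m }) []
      exact ⟨b, a', Reach.head (Reach.head (c := (.pair, { v with bit := m },
        ⟨u.map .inr, [], z, w, e, f, y⟩)) h)⟩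
    | cons x a =>
      obtain ⟨b, a', h⟩ := ih (z := pairSymbol (x, m) :: z) (v := { v with bit := m }) a
      refine ⟨b, a', ?_⟩
      simp only [List.zip_cons_cons, List.map_cons, List.reverse_cons, List.map_append,
        List.map_nil, List.append_assoc, List.cons_append, List.nil_append]
      exact Reach.head (Reach.head (c := (.pair, { v with bit := m },
        ⟨u.map .inr, .inl x :: a.map .inl, z, w, e, f, y⟩)) h)

theorem pairSymbol_elim (a : Bool × Bool) :
    (pairSymbol a).elim id id = a.1 ∧ (pairSymbol a).isRight = a.2 := by
  obtain ⟨x, m⟩ := a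
  cases m <;> simp [pairSymbol]

theorem step_parse_nil :
    step (.parse, v, ⟨i, a, [], w, e, f, y⟩) =
      (if v.state = .start then .take else .clean .inp, { v with answer := false },
        ⟨i, a, [], w, e, f, y⟩) := by
  have h : step (.parse, v, ⟨i, a, [], w, e, f, y⟩) =
      (bif decide (v.state = .start) then .take else .clean .inp, { v with answer := false },
        ⟨i, a, [], w, e, f, y⟩) := rfl
  rw [h, Bool.cond_decide]

theorem step_parse_cons (c : Bool × Bool) :
    step (.parse, v, ⟨i, a, pairSymbol c :: z, w, e, f, y⟩) =
      match v.state.next c.1 c.2 with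
      | none => (.clean .inp, { v with answer := false }, ⟨i, a, z, w, e, f, y⟩)
      | some (p, o) => (.parse, { v with state := p }, ⟨i, a, z, o.toList ++ w, e, f, y⟩) := by
  have h : step (.parse, v, ⟨i, a, pairSymbol c :: z, w, e, f, y⟩) =
      (let t := match v.state.next ((pairSymbol c).elim id id) (pairSymbol c).isRight with
        | none => ((.clean .inp, { v with answer := false }, none) :
          Label × Vars × Option (Bool ⊕ Bool))
        | some (p, o) => (.parse, { v with state := p }, o)
      (t.1, t.2.1, Regs.move ⟨i, a, pairSymbol c :: z, w, e, f, y⟩ .zip .word t.2.2)) := rfl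
  rw [h, (pairSymbol_elim c).1, (pairSymbol_elim c).2]
  cases v.state.next c.1 c.2 with
  | none => rfl
  | some q =>
    obtain ⟨p, o⟩ := q
    cases o <;> rfl

theorem reach_parse_some {z : List (Bool × Bool)} {v : Vars} {E : List (Bool ⊕ Bool)}
    (h : parse v.state z = some E) :
    ∃ v', Reach (z.length + 1) (.parse, v, ⟨i, a, z.map pairSymbol, w, e, f, y⟩)
      (.take, v', ⟨i, a, [], E.reverse ++ w, e, f, y⟩) := by
  induction z generalizing v w E with
  | nil =>
    simp only [parse, Option.ite_none_right_eq_some, Option.some.injEq] at h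
    obtain ⟨hv, rfl⟩ := h
    refine ⟨{ v with answer := false }, Reach.head (Reach.refl _ _) ?_⟩
    rw [List.map_nil, step_parse_nil, if_pos hv]
    rfl
  | cons c z ih =>
    obtain ⟨x, m⟩ := c
    simp only [parse] at h
    cases hp : v.state.next x m with
    | none => simp [hp] at h
    | some q =>
      obtain ⟨p, o⟩ := q
      simp only [hp, Option.map_eq_some_iff] at h
      obtain ⟨E, hE, rfl⟩ := h
      obtain ⟨v', hv'⟩ := ih (v := { v with state := p }) (o.toList ++ w) hE
      have ho : o.toList.reverse = o.toList := by cases o <;> rfl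
      rw [List.reverse_append, ho, List.append_assoc]
      refine ⟨v', Reach.head hv' ?_⟩
      rw [List.map_cons, step_parse_cons]
      simp only [hp]

theorem reach_parse_none {z : List (Bool × Bool)} {v : Vars} (h : parse v.state z = none) :
    ∃ v' S, v'.answer = false ∧ Reach (z.length + 1)
      (.parse, v, ⟨i, a, z.map pairSymbol, w, e, f, y⟩) (.clean .inp, v', S) := by
  induction z generalizing v w with
  | nil =>
    simp only [parse, ite_eq_right_iff, reduceCtorEq, imp_false] at h
    refine ⟨{ v with answer := false }, ⟨i, a, [], w, e, f, y⟩, rfl,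
      Reach.head (Reach.refl _ _) ?_⟩
    rw [List.map_nil, step_parse_nil, if_neg h]
  | cons c z ih =>
    obtain ⟨x, m⟩ := c
    simp only [parse] at h
    cases hp : v.state.next x m with
    | none =>
      refine ⟨{ v with answer := false }, ⟨i, a, z.map pairSymbol, w, e, f, y⟩, rfl,
        Reach.head (Reach.refl _ _) ?_⟩
      rw [List.map_cons, step_parse_cons]
      simp only [hp]
    | some q =>
      obtain ⟨p, o⟩ := q
      simp only [hp, Option.map_eq_none_iff] at h
      obtain ⟨v', S, hv', hr⟩ := ih (v := { v with state := p }) (o.toList ++ w) h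
      refine ⟨v', S, hv', Reach.head hr ?_⟩
      rw [List.map_cons, step_parse_cons]
      simp only [hp]

theorem reach_take (d : List Bool) (m : Bool) :
    Reach (d.length + 1) (.take, v, ⟨i, a, z, d.map .inl ++ .inr m :: w, e, f, y⟩)
      (.restore, { v with value := m }, ⟨i, a, z, w, d.reverse.map .inl ++ e, f, y⟩) := by
  induction d generalizing e with
  | nil => exact (Reach.refl 0 _).head
  | cons b d ih =>
    have h := ih (.inl b :: e)
    simp only [List.map_cons, List.length_cons, List.reverse_cons, List.append_assoc,
      List.cons_append, List.nil_append, List.map_append, List.map_nil]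
    exact h.head

theorem reach_restore :
    Reach (e.length + 1) (.restore, v, ⟨i, a, z, w, e, f, y⟩)
      (.digit, { v with same := true }, ⟨i, a, z, w, [], e.reverse ++ f, y⟩) := by
  induction e generalizing f with
  | nil => exact (Reach.refl 0 _).head
  | cons s e ih =>
    have h := ih (s :: f)
    simp only [List.length_cons, List.reverse_cons, List.append_assoc, List.cons_append,
      List.nil_append]
    exact h.head

theorem reach_rest :
    Reach f.length (.rest, v, ⟨i, a, z, w, e, f, y⟩)
      (.rest, { v with same := v.same && decide (f = []) },
        ⟨i, a, z, w, f.reverse ++ e, [], y⟩) := by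
  induction f generalizing e v with
  | nil => simpa using Reach.refl 0 _
  | cons s f ih =>
    have h := ih (s :: e) { v with same := false }
    simp only [List.length_cons, List.reverse_cons, List.append_assoc, List.cons_append,
      List.nil_append, reduceCtorEq, decide_false, Bool.and_false, Bool.false_and] at h ⊢
    exact h.head

theorem reach_compare (d f : List Bool) (m : Bool) :
    Reach (2 * d.length + f.length + 1)
      (.digit, v, ⟨i, a, z, d.map .inl ++ .inr m :: w, e, f.map .inl, y⟩)
      (.rest, { v with same := v.same && decide (d = f), bit := m },
        ⟨i, a, z, w, f.reverse.map .inl ++ e, [], .inr m :: (d.reverse.map .inl ++ y)⟩) := by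
  induction d generalizing e f y v with
  | nil =>
    have h := reach_rest i a z w e (f.map .inl) (.inr m :: y) { v with bit := m }
    have h2 := Reach.head (c := (.digit, v, ⟨i, a, z, .inr m :: w, e, f.map .inl, y⟩)) h
    have hf : decide (f.map (Sum.inl (β := Bool)) = []) = decide ([] = f) := by cases f <;> simp
    rw [hf, List.length_map, ← List.map_reverse] at h2
    simpa using h2
  | cons b d ih =>
    cases f with
    | nil =>
      have h := ih (e := e) (y := .inl b :: y) (v := { v with bit := b, same := false }) []
      have h2 := Reach.head (c := (.digit, v,
        ⟨i, a, z, .inl b :: (d.map .inl ++ .inr m :: w), e, [], y⟩))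
        (Reach.head (c := (.compare, { v with bit := b },
          ⟨i, a, z, d.map .inl ++ .inr m :: w, e, [], .inl b :: y⟩)) h)
      refine Reach.mono ?_ (show 2 * d.length + 0 + 1 + 1 + 1 ≤ _ by simp; omega)
      simpa using h2
    | cons c f =>
      have h := ih (e := .inl c :: e) (y := .inl b :: y)
        (v := { v with bit := b, same := v.same && ((.inl c : Bool ⊕ Bool) == .inl b) }) f
      have h2 := Reach.head (c := (.digit, v,
        ⟨i, a, z, .inl b :: (d.map .inl ++ .inr m :: w), e, .inl c :: f.map .inl, y⟩))
        (Reach.head (c := (.compare, { v with bit := b },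
          ⟨i, a, z, d.map .inl ++ .inr m :: w, e, .inl c :: f.map .inl, .inl b :: y⟩)) h)
      refine Reach.mono ?_ (show 2 * d.length + f.length + 1 + 1 + 1 ≤ _ by simp; omega)
      have hs : (v.same && ((.inl c : Bool ⊕ Bool) == .inl b) && decide (d = f)) =
          (v.same && decide (b :: d = c :: f)) := by
        have hbc : ((.inl c : Bool ⊕ Bool) == .inl b) = (b == c) := by
          cases b <;> cases c <;> rfl
        rw [hbc, Bool.eq_iff_iff]
        simp only [Bool.and_eq_true, beq_iff_eq, decide_eq_true_eq, List.cons.injEq, and_assoc]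
      rw [← hs]
      simpa using h2

theorem step_rest_nil :
    step (.rest, v, ⟨i, a, z, w, e, [], y⟩) =
      (if v.same = true ∧ v.value ≠ v.bit then .clean .inp else .restore,
        { v with answer := false }, ⟨i, a, z, w, e, [], y⟩) := by
  have h : step (.rest, v, ⟨i, a, z, w, e, [], y⟩) =
      (bif v.same && v.value != v.bit then .clean .inp else .restore,
        { v with answer := false }, ⟨i, a, z, w, e, [], y⟩) := rfl
  rw [h, Bool.cond_eq_ite]
  simp only [Bool.and_eq_true, bne_iff_ne]

theorem reach_compare_conflict {v : Vars} (hv : v.same = true) (d : List Bool) {m : Bool}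
    (hm : v.value ≠ m) :
    ∃ v' S, v'.answer = false ∧ Reach (3 * d.length + 2)
      (.digit, v, ⟨i, a, z, d.map .inl ++ .inr m :: w, [], d.map .inl, y⟩)
      (.clean .inp, v', S) := by
  have hcompare := reach_compare i a z w [] y v d d m
  set v₁ : Vars := { v with same := v.same && decide (d = d), bit := m }
  set S : Regs := ⟨i, a, z, w, d.reverse.map .inl ++ [], [], .inr m :: (d.reverse.map .inl ++ y)⟩
  have hstep : step (.rest, v₁, S) = (.clean .inp, { v₁ with answer := false }, S) := by
    rw [step_rest_nil, if_pos ⟨by simp [v₁, hv], hm⟩]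
  exact ⟨{ v₁ with answer := false }, S, rfl,
    (hcompare.trans ((Reach.refl 0 _).head hstep)).mono (by omega)⟩

theorem reach_compare_agree {v : Vars} (hv : v.same = true) {d d' : List Bool} {m : Bool}
    (hm : d' = d → m = v.value) :
    ∃ v', v'.same = true ∧ v'.value = v.value ∧ Reach (2 * d'.length + 2 * d.length + 3)
      (.digit, v, ⟨i, a, z, d'.map .inl ++ .inr m :: w, [], d.map .inl, y⟩)
      (.digit, v', ⟨i, a, z, w, [], d.map .inl, .inr m :: (d'.reverse.map .inl ++ y)⟩) := by
  have hcompare := reach_compare i a z w [] y v d' d m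
  set v₁ : Vars := { v with same := v.same && decide (d' = d), bit := m } with hv₁
  set y' := Sum.inr m :: (d'.reverse.map .inl ++ y)
  have hrestore := reach_restore i a z w (d.reverse.map .inl) [] y' { v₁ with answer := false }
  have hstep : step (.rest, v₁, ⟨i, a, z, w, d.reverse.map .inl, [], y'⟩) =
      (.restore, { v₁ with answer := false }, ⟨i, a, z, w, d.reverse.map .inl, [], y'⟩) := by
    rw [step_rest_nil, if_neg]
    rintro ⟨hsame, hne⟩
    simp only [hv₁, hv, Bool.true_and, decide_eq_true_eq] at hsame hne
    exact hne (hm hsame).symm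
  rw [List.append_nil] at hcompare
  have h := (hcompare.trans (hrestore.head hstep)).mono
    (show _ ≤ 2 * d'.length + 2 * d.length + 3 by
      rw [List.length_map, List.length_reverse]
      omega)
  rw [← List.map_reverse (l := d.reverse), List.reverse_reverse, List.append_nil] at h
  exact ⟨{ v₁ with same := true, answer := false }, rfl, rfl, h⟩

/-- A bound on the time needed to compare a block with `k` digits with blocks of total length
`n`. -/
def passTime (n k : ℕ) : ℕ := n * (2 * k + 4) + 1

theorem add_passTime_le (k k' n : ℕ) :
    2 * k' + 2 * k + 3 + passTime n k ≤ passTime (k' + (n + 1)) k := by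
  unfold passTime
  nlinarith

theorem reach_pass_agree (d : List Bool) (B : List (List Bool × Bool)) {v : Vars}
    (hv : v.same = true) (hB : ∀ b ∈ B, b.1 = d → b.2 = v.value) :
    ∃ v', Reach (passTime (blockSymbols B).length d.length)
      (.digit, v, ⟨i, a, z, blockSymbols B, [], d.map .inl, y⟩)
      (.back, v', ⟨i, a, z, [], [], d.map .inl, (blockSymbols B).reverse ++ y⟩) := by
  induction B generalizing y v with
  | nil => exact ⟨v, ((Reach.refl 0 _).head).mono (by simp [passTime])⟩
  | cons b B ih =>
    obtain ⟨d', m⟩ := b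
    obtain ⟨hm, hB⟩ := List.forall_mem_cons.1 hB
    obtain ⟨v₁, hv₁, hval, hfirst⟩ := reach_compare_agree i a z (blockSymbols B) y hv hm
    obtain ⟨v', hrest⟩ := ih _ hv₁ (by rwa [hval])
    refine ⟨v', ?_⟩
    have h := (hfirst.trans hrest).mono (add_passTime_le _ _ _)
    simpa using h

theorem reach_pass_conflict (d : List Bool) (B : List (List Bool × Bool)) {v : Vars}
    (hv : v.same = true) (hB : ¬ ∀ b ∈ B, b.1 = d → b.2 = v.value) :
    ∃ v' S, v'.answer = false ∧ Reach (passTime (blockSymbols B).length d.length)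
      (.digit, v, ⟨i, a, z, blockSymbols B, [], d.map .inl, y⟩) (.clean .inp, v', S) := by
  induction B generalizing y v with
  | nil => exact absurd (List.forall_mem_nil _) hB
  | cons b B ih =>
    obtain ⟨d', m⟩ := b
    have htime : passTime (blockSymbols ((d', m) :: B)).length d.length =
        passTime (d'.length + ((blockSymbols B).length + 1)) d.length := by simp
    have hle := add_passTime_le d.length d'.length (blockSymbols B).length
    rw [htime, blockSymbols_cons]
    by_cases hm : d' = d → m = v.value
    · obtain ⟨v₁, hv₁, hval, hfirst⟩ := reach_compare_agree i a z (blockSymbols B) y hv hm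
      obtain ⟨v', S, hv', hrest⟩ := ih _ hv₁ fun h =>
        hB (List.forall_mem_cons.2 ⟨hm, by rwa [hval] at h⟩)
      exact ⟨v', S, hv', (hfirst.trans hrest).mono hle⟩
    · obtain ⟨rfl, hne⟩ := Classical.not_imp.1 hm
      obtain ⟨v', S, hv', h⟩ :=
        reach_compare_conflict i a z (blockSymbols B) y hv d' (Ne.symm hne)
      exact ⟨v', S, hv', h.mono (by omega)⟩

theorem reach_back :
    Reach (y.length + 1) (.back, v, ⟨i, a, z, w, e, f, y⟩)
      (.clear, v, ⟨i, a, z, y.reverse ++ w, e, f, []⟩) := by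
  induction y generalizing w with
  | nil => exact (Reach.refl 0 _).head
  | cons s y ih =>
    have h := ih (s :: w)
    simp only [List.length_cons, List.reverse_cons, List.append_assoc, List.cons_append,
      List.nil_append]
    exact h.head

theorem reach_clear :
    Reach (f.length + 1) (.clear, v, ⟨i, a, z, w, e, f, y⟩)
      (.take, v, ⟨i, a, z, w, e, [], y⟩) := by
  induction f with
  | nil => exact (Reach.refl 0 _).head
  | cons s f ih => exact ih.head

theorem reach_fetch (d : List Bool) (m : Bool) :
    Reach (2 * d.length + 2) (.take, v, ⟨i, a, z, d.map .inl ++ .inr m :: w, [], [], []⟩)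
      (.digit, { v with value := m, same := true }, ⟨i, a, z, w, [], d.map .inl, []⟩) := by
  have htake := reach_take i a z w [] [] [] v d m
  have hrestore := reach_restore i a z w (d.reverse.map .inl) [] [] { v with value := m }
  rw [List.append_nil] at htake
  have h := htake.trans hrestore
  rw [← List.map_reverse, List.reverse_reverse, List.append_nil] at h
  refine h.mono ?_
  rw [List.length_map, List.length_reverse]
  omega

/-- A bound on the time needed to fetch a block and to compare it with the others, where `n` is the
total length of the blocks. -/
def roundTime (n : ℕ) : ℕ := passTime n n + 5 * n + 5

theorem passTime_le_of_length_le {B : List (List Bool × Bool)} {d : List Bool} {m : Bool} {n : ℕ}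
    (hn : (blockSymbols ((d, m) :: B)).length ≤ n) :
    passTime (blockSymbols B).length d.length + 2 * d.length + 2 + (blockSymbols B).length + 1 +
      d.length + 1 ≤ roundTime n := by
  simp only [blockSymbols_cons, List.length_append, List.length_map, List.length_cons] at hn
  have : (blockSymbols B).length * (2 * d.length + 4) ≤ n * (2 * n + 4) := by gcongr <;> omega
  unfold roundTime passTime
  omega

theorem reach_round_agree {d : List Bool} {m : Bool} {B : List (List Bool × Bool)} {n : ℕ}
    (hn : (blockSymbols ((d, m) :: B)).length ≤ n) (hB : ∀ b ∈ B, b.1 = d → b.2 = m) :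
    ∃ v', Reach (roundTime n)
      (.take, v, ⟨i, a, z, blockSymbols ((d, m) :: B), [], [], []⟩)
      (.take, v', ⟨i, a, z, blockSymbols B, [], [], []⟩) := by
  have hfetch := reach_fetch i a z (blockSymbols B) v d m
  obtain ⟨v', hpass⟩ := reach_pass_agree i a z [] d B (v := { v with value := m, same := true })
    rfl hB
  have hback := reach_back i a z [] [] (d.map .inl) ((blockSymbols B).reverse ++ []) v'
  have hclear := reach_clear i a z (blockSymbols B) [] (d.map .inl) [] v'
  simp only [List.append_nil, List.reverse_reverse, List.length_reverse, List.length_map]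
    at hpass hback hclear
  rw [blockSymbols_cons]
  refine ⟨v', (((hfetch.trans hpass).trans hback).trans hclear).mono ?_⟩
  have := passTime_le_of_length_le hn
  omega

theorem reach_round_conflict {d : List Bool} {m : Bool} {B : List (List Bool × Bool)} {n : ℕ}
    (hn : (blockSymbols ((d, m) :: B)).length ≤ n) (hB : ¬ ∀ b ∈ B, b.1 = d → b.2 = m) :
    ∃ v' S, v'.answer = false ∧ Reach (roundTime n)
      (.take, v, ⟨i, a, z, blockSymbols ((d, m) :: B), [], [], []⟩) (.clean .inp, v', S) := by
  have hfetch := reach_fetch i a z (blockSymbols B) v d m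
  obtain ⟨v', S, hv', hpass⟩ := reach_pass_conflict i a z [] d B
    (v := { v with value := m, same := true }) rfl hB
  rw [blockSymbols_cons]
  refine ⟨v', S, hv', (hfetch.trans hpass).mono ?_⟩
  have := passTime_le_of_length_le hn
  omega

theorem reach_consistent {B : List (List Bool × Bool)} {n : ℕ} (hn : (blockSymbols B).length ≤ n) :
    ∃ v' S, (v'.answer = true ↔ ConsistentBlocks B) ∧ Reach ((B.length + 1) * roundTime n)
      (.take, v, ⟨i, a, z, blockSymbols B, [], [], []⟩) (.clean .inp, v', S) := by
  induction B generalizing v with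
  | nil =>
    exact ⟨{ v with answer := true }, _, by simp [ConsistentBlocks],
      (Reach.refl 0 _).head.mono (by simp [roundTime])⟩
  | cons b B ih =>
    obtain ⟨d, m⟩ := b
    have hcons : ConsistentBlocks ((d, m) :: B) ↔
        (∀ b ∈ B, b.1 = d → b.2 = m) ∧ ConsistentBlocks B := List.pairwise_cons
    by_cases hB : ∀ b ∈ B, b.1 = d → b.2 = m
    · obtain ⟨v₁, hround⟩ := reach_round_agree i a z v hn hB
      obtain ⟨v', S, hv', hrest⟩ := ih v₁ (le_trans (by simp; omega) hn)
      refine ⟨v', S, by rw [hv', hcons, and_iff_right hB], (hround.trans hrest).mono ?_⟩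
      rw [List.length_cons, add_one_mul (B.length + 1), add_comm]
    · obtain ⟨v', S, hv', hround⟩ := reach_round_conflict i a z v hn hB
      have hinconsistent : ¬ ConsistentBlocks ((d, m) :: B) := fun h => hB (hcons.1 h).1
      exact ⟨v', S, by simp [hv', hinconsistent],
        hround.mono (Nat.le_mul_of_pos_left _ (Nat.succ_pos _))⟩

end Stacks

theorem length_le_length_blockSymbols (B : List (List Bool × Bool)) :
    B.length ≤ (blockSymbols B).length := by
  induction B with
  | nil => exact Nat.zero_le _
  | cons b B ih =>
    simp only [List.length_cons, blockSymbols_cons, List.length_append]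
    omega

/-- The initial values of the variables. -/
def initVars : Vars := ⟨.start, false, false, false, false⟩

/-- The initial stacks for a word `x` with certificate `u`. -/
def Regs.input (x u : List Bool) : Regs := ⟨x.map .inl ++ u.map .inr, [], [], [], [], [], []⟩

theorem reach_parse (x u : List Bool) :
    ∃ (v : Vars) (a : List (Bool ⊕ Bool)), v.state = .start ∧
      Reach (x.length + (2 * u.length + 1)) (.read, initVars, .input x u)
        (.parse, v, ⟨[], a, (x.reverse.zip u).reverse.map pairSymbol, [], [], [], []⟩) := by
  have hword := reach_read_word [] [] [] [] [] [] initVars x (u.map .inr)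
  obtain ⟨b, a, hcert⟩ := reach_read_certificate [] [] [] [] [] initVars u x.reverse
  rw [List.append_nil] at hword hcert
  exact ⟨{ initVars with bit := b }, a, rfl, hword.trans hcert⟩

theorem reach_answer {x u : List Bool} {n : ℕ} (hn : x.length + u.length ≤ n) :
    ∃ v S, v.answer = verify x u ∧ Reach (3 * n + 2 + (n + 1) * roundTime n)
      (.read, initVars, .input x u) (.clean .inp, v, S) := by
  obtain ⟨v₀, a, hstart, hread⟩ := reach_parse x u
  have hlen : (x.reverse.zip u).reverse.length ≤ x.length := by simp
  cases hp : parse .start (x.reverse.zip u).reverse with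
  | none =>
    rw [← hstart] at hp
    obtain ⟨v, S, hv, hparse⟩ := reach_parse_none [] a [] [] [] [] hp
    rw [hstart] at hp
    exact ⟨v, S, by rw [hv, verify_eq_false hp], (hread.trans hparse).mono (by omega)⟩
  | some E =>
    obtain ⟨B, rfl⟩ := parse_eq_blocks hp
    rw [← hstart] at hp
    obtain ⟨v₁, hparse⟩ := reach_parse_some [] a [] [] [] [] hp
    rw [hstart] at hp
    rw [List.reverse_reverse, List.append_nil] at hparse
    have hB : (blockSymbols B).length ≤ n := by
      have hsize := (hread.trans hparse).size_le
      simp only [Regs.size, Regs.input, List.length_append, List.length_map, List.length_nil]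
        at hsize
      omega
    obtain ⟨v, S, hv, hcheck⟩ := reach_consistent [] a [] v₁ hB
    refine ⟨v, S, by rw [Bool.eq_iff_iff, hv, verify_eq_true_iff hp],
      ((hread.trans hparse).trans hcheck).mono ?_⟩
    have : (B.length + 1) * roundTime n ≤ (n + 1) * roundTime n := by
      gcongr
      exact (length_le_length_blockSymbols B).trans hB
    omega

/-- A bound on the running time of the machine on inputs of length `n`. -/
def runTime (n : ℕ) : ℕ := (n + 1) * roundTime n + 4 * n + 9

theorem reach_finish (x u : List Bool) :
    ∃ v, v.answer = verify x u ∧ Reach (runTime (x.length + u.length))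
      (.read, initVars, .input x u) (.finish, v, .empty) := by
  obtain ⟨v, S, hv, h⟩ := reach_answer (x := x) (u := u) le_rfl
  refine ⟨v, hv, (h.trans (reach_clean v S)).mono ?_⟩
  have hsize : S.size ≤ x.length + u.length := by
    simpa [Regs.size, Regs.input] using h.size_le
  unfold runTime
  omega

/-- Stack alphabets of the Turing machine: the output stack and the working stacks. -/
abbrev StackAlphabet : Option Reg → Type
  | none => Bool
  | some _ => Bool ⊕ Bool

/-- States of the Turing machine: variables, next label, and symbol to be pushed. -/
abbrev MachineState : Type := Vars × Label × Option (Bool ⊕ Bool)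

/-- The statement of the Turing machine performing the transition at the label `l`. -/
def transitionStmt (l : Label) : TM2.Stmt StackAlphabet Label MachineState :=
  .pop (some (source l))
    (fun v s => ((transition l v.1 s).2.1, (transition l v.1 s).1, (transition l v.1 s).2.2))
    (.branch (fun v => v.2.2.isSome)
      (.push (some (target l)) (fun v => v.2.2.getD (.inl false)) (.goto fun v => v.2.1))
      (.goto fun v => v.2.1))

/-- The program of the Turing machine. -/
def program : Label → TM2.Stmt StackAlphabet Label MachineState
  | .finish => .push none (fun v => v.1.answer) (.load (fun _ => (initVars, .read, none)) .halt)
  | l => transitionStmt l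

theorem program_of_ne_finish {l : Label} (hl : l ≠ .finish) : program l = transitionStmt l := by
  cases l <;> first | rfl | exact absurd rfl hl

/-- The Turing machine deciding `verify`. -/
def machine : FinTM2 where
  K := Option Reg
  k₀ := some .inp
  k₁ := none
  Γ := StackAlphabet
  Λ := Label
  main := .read
  σ := MachineState
  initialState := (initVars, .read, none)
  Γk₀Fin := inferInstanceAs (Fintype (Bool ⊕ Bool))
  m := program

/-- The stacks of the Turing machine, consisting of the working stacks and the output `o`. -/
def allStacks (S : Regs) (o : List Bool) : ∀ k, List (StackAlphabet k)
  | none => o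
  | some r => S.get r

theorem update_allStacks (S : Regs) (o : List Bool) (r : Reg) (L : List (Bool ⊕ Bool)) :
    Function.update (allStacks S o) (some r) L = allStacks (S.set r L) o := by
  funext k
  cases k with
  | none => rfl
  | some r' =>
    by_cases h : r' = r
    · subst h
      rw [Function.update_self]
      exact (Regs.get_set_self _ _ _).symm
    · rw [Function.update_of_ne (by simpa using h)]
      cases r <;> cases r' <;> first | rfl | exact absurd rfl h

theorem machine_step {l : Label} (hl : l ≠ .finish) (v : Vars)
    (j : Label × Option (Bool ⊕ Bool)) (S : Regs) :
    ∃ j', TM2.step program ⟨some l, (v, j), allStacks S []⟩ =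
      some ⟨some (step (l, v, S)).1, ((step (l, v, S)).2.1, j'),
        allStacks (step (l, v, S)).2.2 []⟩ := by
  have hget : ∀ (S : Regs) r, allStacks S [] (some r) = S.get r := fun _ _ => rfl
  rw [step_of_ne_finish hl]
  simp only [TM2.step, program_of_ne_finish hl, transitionStmt, TM2.stepAux, update_allStacks, hget]
  generalize transition l v (S.get (source l)).head? = t
  obtain ⟨l', v', o⟩ := t
  cases o with
  | none => exact ⟨_, rfl⟩
  | some s => exact ⟨_, rfl⟩

theorem machine_iterate {s : ℕ} {l : Label} {v v' : Vars} {S S' : Regs}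
    (h : step^[s] (l, v, S) = (.finish, v', S')) (j : Label × Option (Bool ⊕ Bool)) :
    ∃ s' ≤ s, ∃ j', (flip bind (TM2.step program))^[s']
        (some ⟨some l, (v, j), allStacks S []⟩) =
      some ⟨some .finish, (v', j'), allStacks S' []⟩ := by
  induction s generalizing l v S j with
  | zero =>
    obtain ⟨rfl, rfl, rfl⟩ : l = .finish ∧ v = v' ∧ S = S' := by simpa using h
    exact ⟨0, le_rfl, j, rfl⟩
  | succ s ih =>
    rw [Function.iterate_succ_apply] at h
    by_cases hl : l = .finish
    · subst hl
      obtain ⟨s', hs', hj⟩ := ih h j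
      exact ⟨s', hs'.trans (Nat.le_succ s), hj⟩
    · obtain ⟨j₁, hfirst⟩ := machine_step hl v j S
      rcases hc : step (l, v, S) with ⟨l₁, v₁, S₁⟩
      rw [hc] at h hfirst
      obtain ⟨s', hs', j', hrest⟩ := ih h j₁
      refine ⟨s' + 1, Nat.succ_le_succ hs', j', ?_⟩
      rw [Function.iterate_succ_apply, ← hrest, ← hfirst]
      rfl

theorem initList_machine (x u : List Bool) :
    initList machine (x.map .inl ++ u.map .inr) =
      ⟨some .read, (initVars, .read, none), allStacks (.input x u) []⟩ := by
  refine congrArg (TM2.Cfg.mk _ _) (funext fun k => ?_)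
  cases k with
  | none => rfl
  | some r => cases r <;> rfl

theorem haltList_machine (b : Bool) :
    haltList machine [b] = ⟨none, (initVars, .read, none), allStacks .empty [b]⟩ := by
  refine congrArg (TM2.Cfg.mk _ _) (funext fun k => ?_)
  cases k with
  | none => rfl
  | some r => cases r <;> rfl

theorem machine_finish (v : Vars) (j : Label × Option (Bool ⊕ Bool)) :
    TM2.step program ⟨some .finish, (v, j), allStacks .empty []⟩ =
      some ⟨none, (initVars, .read, none), allStacks .empty [v.answer]⟩ := by
  have h : Function.update (allStacks .empty []) none [v.answer] = allStacks .empty [v.answer] := by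
    funext k
    cases k <;> rfl
  rw [← h]
  rfl

theorem machine_outputs (x u : List Bool) :
    ∃ s ≤ runTime (x.length + u.length) + 1,
      (flip bind machine.step)^[s] (some (initList machine (x.map .inl ++ u.map .inr))) =
        some (haltList machine [verify x u]) := by
  obtain ⟨v, hv, s, hs, h⟩ := reach_finish x u
  obtain ⟨s', hs', j, hj⟩ := machine_iterate h (.read, none)
  refine ⟨s' + 1, by omega, ?_⟩
  rw [haltList_machine, initList_machine, Function.iterate_succ_apply', ← hv]
  exact (congrArg (flip bind (TM2.step program)) hj).trans (machine_finish v j)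

end Verifier

open Polynomial in
theorem polyTimeVerifier_verify : PolyTimeVerifier verify := by
  refine ⟨⟨⟨Verifier.machine, Equiv.refl _, Equiv.refl _⟩,
    (X + 1) * (X * (2 * X + 4) + 5 * X + 6) + 4 * X + 10, fun xu => ?_⟩⟩
  have h := Verifier.machine_outputs xu.1 xu.2
  refine ⟨⟨h.choose, ?_⟩, ?_⟩
  · have hencode : ((Computability.encodingProd (Computability.encodingList Bool)
        (Computability.encodingList Bool)).encode xu).map (Equiv.refl (Bool ⊕ Bool)).invFun =
        xu.1.map .inl ++ xu.2.map .inr := by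
      simp [Computability.encodingProd, Computability.encodingList]
    exact (congrArg (fun w => (flip bind Verifier.machine.step)^[h.choose]
      (some (initList Verifier.machine w))) hencode).trans h.choose_spec.2
  · have hlength : ((Computability.encodingProd (Computability.encodingList Bool)
        (Computability.encodingList Bool)).encode xu).length = xu.1.length + xu.2.length := by
      simp [Computability.encodingProd, Computability.encodingList]
    refine h.choose_spec.1.trans (le_of_eq ?_)
    simp only [Verifier.runTime, Verifier.roundTime, Verifier.passTime, hlength, eval_add, eval_mul,
      eval_X, eval_one, eval_ofNat]
    ring

theorem threeSAT_mem_NP : threeSAT ∈ NP :=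
  ⟨fun n => n, ⟨Polynomial.X, fun n => by simp⟩, verify, polyTimeVerifier_verify,
    mem_threeSAT_iff_verify⟩

end NonuniformIS

theorem mainTheorem5 (α : NonuniformIS.DisjNumbering) :
    (NonuniformIS.threeSATC α ∉ NonuniformIS.PLIS ↔
        NonuniformIS.threeSAT ∉ NonuniformIS.PPoly) ∧
      (NonuniformIS.threeSATC α ∉ NonuniformIS.PLIS ↔
        ¬ NonuniformIS.NP ⊆ NonuniformIS.PPoly) := by
  rw [NonuniformIS.PLIS_eq_PolySize, not_iff_not, not_iff_not]
  have hNP : NonuniformIS.threeSATC α ∈ NonuniformIS.PolySize →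
      NonuniformIS.NP ⊆ NonuniformIS.PPoly := fun hα L hL =>
    NonuniformIS.mem_PPoly_iff.2 (NonuniformIS.NondetPolySize_subset_PolySize hα
      (NonuniformIS.charFamily_mem_NondetPolySize hL))
  have hSAT : NonuniformIS.NP ⊆ NonuniformIS.PPoly →
      NonuniformIS.threeSAT ∈ NonuniformIS.PPoly := fun h => h NonuniformIS.threeSAT_mem_NP
  have hSATC : NonuniformIS.threeSAT ∈ NonuniformIS.PPoly →
      NonuniformIS.threeSATC α ∈ NonuniformIS.PolySize := NonuniformIS.threeSATC_mem_PolySize α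
  exact ⟨⟨fun h => hSAT (hNP h), hSATC⟩, ⟨hNP, fun h => hSATC (hSAT h)⟩⟩
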